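/- Let $0\le k<n$. A Le-diagram $D$ of type $(k,n)$ is a Young diagram contained in a $k\times(n-k)$ rectangle whose boxes are filled with $0$'s and $+$'s such that no $0$ has both a $+$ above it in the same column and a $+$ to its left in the same row. Label the steps of its southeast border (the path from the northeast to the southwest corner of the rectangle) by $1,\dots,n$. From each $+$ draw a hook going east and south to the border. Replace each $+$ by a black vertex, attached to the edges on the east and north sides, and a white vertex, attached to the edges on the west and south sides, joined to each other by an edge; attach a black lollipop to the label of each column without $+$ and a white lollipop to the label of each row without $+$. This gives the plabic graph $G(D)$ with boundary vertices $1,\dots,n$. Let $M(D)\subseteq\binom{[n]}{k}$ be the positroid whose bases are the source sets of the perfect orientations of $G(D)$ (orientations in which each black internal vertex has exactly one outgoing edge and each white internal vertex exactly one incoming edge), and let $$S_D=\Big\{V\in \mathrm{Gr}_{k,n}(\mathbb R): \Delta_I(V)>0 \text{ for } I\in M(D),\ \Delta_I(V)=0 \text{ for } I\in\tbinom{[n]}{k}\setminus M(D)\Big\}$$ be the corresponding cell of the totally nonnegative Grassmannian, where the Plücker coordinates $\Delta_I(V)$ are defined up to a common nonzero factor. Let $W\subseteq\mathbb R^n$ be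 a $(k+1)$-dimensional subspace all of whose Plücker coordinates are positive. Then for every Le-diagram $D$ of type $(k,n)$, the set of lines $$\mathcal B_D(W)=\{V^\perp\cap W: V\in S_D\}$$ (the image of $S_D$ in the $m=1$ amplituhedron) has dimension equal to the number $d$ of rows of $D$ which contain a $+$. That is, as a subset of the Grassmannian (with subspaces identified with their orthogonal projections), $\mathcal B_D(W)$ contains a homeomorphic copy of $\mathbb R^d$ and has Hausdorff dimension $d$. -/

import Mathlib

/-- A Le-diagram of type `(k, n)`: a Young diagram (English notation: row index increasing
downwards, column index increasing to the right, both counted from `0`) inside a `k × (n - k)`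
rectangle, whose boxes are filled with `0`'s and `+`'s so that no `0` has both a `+` above it in
its column and a `+` to its left in its row. `plus` is the set of boxes holding a `+`. -/
structure LeDiagram (k n : ℕ) where
  k_le : k ≤ n
  shape : YoungDiagram
  shape_sub : ∀ p ∈ shape, p.1 < k ∧ p.2 < n - k
  plus : Finset (Fin k × Fin (n - k))
  plus_sub : ∀ p ∈ plus, ((p.1 : ℕ), (p.2 : ℕ)) ∈ shape
  le_property : ∀ (r r' : Fin k) (c c' : Fin (n - k)), ((r : ℕ), (c : ℕ)) ∈ shape →
    r' < r → c' < c → (r', c) ∈ plus → (r, c') ∈ plus → (r, c) ∈ plus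

namespace LeDiagram

variable {k n : ℕ}

/-- The number of rows which contain a `+`. -/
def numPlusRows (D : LeDiagram k n) : ℕ := (D.plus.image Prod.fst).card

theorem rowLabel_lt (D : LeDiagram k n) (r : Fin k) :
    (r : ℕ) + (n - k - D.shape.rowLen r) < n := by
  have := r.2
  have := D.k_le
  omega

theorem colLabel_lt (D : LeDiagram k n) (c : Fin (n - k)) :
    D.shape.colLen c + (n - k - 1 - (c : ℕ)) < n := by
  have hc := c.2
  have : D.shape.colLen c ≤ k := by
    by_contra h
    have hm : (k, (c : ℕ)) ∈ D.shape := YoungDiagram.mem_iff_lt_colLen.2 (by omega)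
    have := (D.shape_sub _ hm).1
    simp at this
  omega

/-- Label the `n` steps of the southeast border, from the northeast to the southwest corner of the
rectangle, by `0, …, n - 1`. This is the label of the vertical step at the end of row `r`: it is
preceded by `r` vertical steps and by the horizontal steps of the columns right of row `r`. -/
def rowLabel (D : LeDiagram k n) (r : Fin k) : Fin n :=
  ⟨r + (n - k - D.shape.rowLen r), D.rowLabel_lt r⟩

/-- The label of the horizontal step at the end of column `c`: it is preceded by the vertical steps
of the rows meeting column `c` and by the horizontal steps of the columns to the right of `c`. -/
def colLabel (D : LeDiagram k n) (c : Fin (n - k)) : Fin n :=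
  ⟨D.shape.colLen c + (n - k - 1 - c), D.colLabel_lt c⟩

/-- The internal vertices of the plabic graph `G(D)`: every `+` is replaced by a black vertex and a
white vertex; every column without `+` carries a black lollipop, every row without `+` a white
lollipop. -/
inductive Vertex (D : LeDiagram k n) : Type
  | black (p : Fin k × Fin (n - k)) (hp : p ∈ D.plus)
  | white (p : Fin k × Fin (n - k)) (hp : p ∈ D.plus)
  | blackLeaf (c : Fin (n - k)) (hc : ∀ r, (r, c) ∉ D.plus)
  | whiteLeaf (r : Fin k) (hr : ∀ c, (r, c) ∉ D.plus)

/-- The black internal vertices of `G(D)`; all the other internal vertices are white. -/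
inductive IsBlack (D : LeDiagram k n) : D.Vertex → Prop
  | black (p) (hp : p ∈ D.plus) : IsBlack D (.black p hp)
  | leaf (c) (hc : ∀ r, (r, c) ∉ D.plus) : IsBlack D (.blackLeaf c hc)

/-- The edges of `G(D)`, directed down and to the left. The boundary vertices are `Sum.inl i` with
`i` a label of a border step. In the hook diagram every `+` has an edge going east and an edge going
south, each of which ends at the next `+` that it meets or, if there is none, at the border. At each
`+`, the (incoming) edges on its east and north sides are attached to its black vertex, the
(outgoing) edges on its west and south sides are attached to its white vertex, and the two vertices
are joined by an edge. -/
inductive Arc (D : LeDiagram k n) : Fin n ⊕ D.Vertex → Fin n ⊕ D.Vertex → Prop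
  | middle (p) (hp : p ∈ D.plus) : Arc D (.inr (.black p hp)) (.inr (.white p hp))
  | left (r) (c c') (hp : (r, c) ∈ D.plus) (hp' : (r, c') ∈ D.plus) (hlt : c < c')
      (hnext : ∀ c'', c < c'' → c'' < c' → (r, c'') ∉ D.plus) :
      Arc D (.inr (.white (r, c') hp')) (.inr (.black (r, c) hp))
  | down (r r') (c) (hp : (r, c) ∈ D.plus) (hp' : (r', c) ∈ D.plus) (hlt : r < r')
      (hnext : ∀ r'', r < r'' → r'' < r' → (r'', c) ∉ D.plus) :
      Arc D (.inr (.white (r, c) hp)) (.inr (.black (r', c) hp'))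
  | enter (r) (c) (hp : (r, c) ∈ D.plus) (hlast : ∀ c', c < c' → (r, c') ∉ D.plus) :
      Arc D (.inl (D.rowLabel r)) (.inr (.black (r, c) hp))
  | exit (r) (c) (hp : (r, c) ∈ D.plus) (hlast : ∀ r', r < r' → (r', c) ∉ D.plus) :
      Arc D (.inr (.white (r, c) hp)) (.inl (D.colLabel c))
  | whiteLollipop (r) (hr : ∀ c, (r, c) ∉ D.plus) :
      Arc D (.inl (D.rowLabel r)) (.inr (.whiteLeaf r hr))
  | blackLollipop (c) (hc : ∀ r, (r, c) ∉ D.plus) :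
      Arc D (.inr (.blackLeaf c hc)) (.inl (D.colLabel c))

/-- The underlying undirected graph of the plabic graph `G(D)`. -/
def plabicGraph (D : LeDiagram k n) : SimpleGraph (Fin n ⊕ D.Vertex) := SimpleGraph.fromRel D.Arc

end LeDiagram

/-- `o` (where `o x y` means that there is an edge directed from `x` to `y`) is a perfect orientation
of the graph `G` with boundary vertices `Fin n` and internal vertices `V`, an internal vertex `v`
being black if `black v` and white otherwise: every edge is directed in exactly one way, every black
vertex has exactly one outgoing edge, and every white vertex has exactly one incoming edge. -/
def IsPerfectOrientation {n : ℕ} {V : Type} (G : SimpleGraph (Fin n ⊕ V)) (black : V → Prop)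
    (o : Fin n ⊕ V → Fin n ⊕ V → Prop) : Prop :=
  (∀ x y, G.Adj x y ↔ (o x y ∨ o y x)) ∧ (∀ x y, o x y → ¬ o y x) ∧
  (∀ v, black v → ∃! x, o (Sum.inr v) x) ∧ (∀ v, ¬ black v → ∃! x, o x (Sum.inr v))

/-- The positroid `M(D)`, given by its bases: the source sets of the perfect orientations of the
plabic graph of `D`. -/
def LeDiagram.positroid {k n : ℕ} (D : LeDiagram k n) : Set (Finset (Fin n)) :=
  {I | ∃ o, IsPerfectOrientation D.plabicGraph D.IsBlack o ∧
    ∀ i, i ∈ I ↔ ∃ x, o (Sum.inl i) x}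

/-- The maximal minor of the `k × n` matrix `A` located in the column set `I`. -/
def plucker {k n : ℕ} (A : Matrix (Fin k) (Fin n) ℝ) (I : {I : Finset (Fin n) // I.card = k}) : ℝ :=
  (A.submatrix id (I.1.orderEmbOfFin I.2)).det

/-- `V` is a point of the Grassmannian `Gr_{k,n}`, with the rows of `A` as a basis. -/
def Represents {k n : ℕ} (A : Matrix (Fin k) (Fin n) ℝ)
    (V : Submodule ℝ (EuclideanSpace ℝ (Fin n))) : Prop :=
  Module.finrank ℝ V = k ∧ Submodule.span ℝ (Set.range fun i => WithLp.toLp 2 (A i)) = V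

/-- The totally positive Grassmannian `Gr_{k,n}^{>0}`. Plücker coordinates are defined up to a
common nonzero factor, hence the choice of a representative. -/
def totallyPositiveGrassmannian (k n : ℕ) : Set (Submodule ℝ (EuclideanSpace ℝ (Fin n))) :=
  {V | ∃ A : Matrix (Fin k) (Fin n) ℝ, Represents A V ∧ ∀ I, 0 < plucker A I}

/-- The positive Grassmann cell `S_M` in `Gr_{k,n}^{≥0}`: the Plücker coordinates in `M` are
positive and all the others are zero. -/
def positiveCell (k n : ℕ) (M : Set (Finset (Fin n))) :
    Set (Submodule ℝ (EuclideanSpace ℝ (Fin n))) :=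
  {V | ∃ A : Matrix (Fin k) (Fin n) ℝ, Represents A V ∧
    ∀ I, (I.1 ∈ M → 0 < plucker A I) ∧ (I.1 ∉ M → plucker A I = 0)}

/-- The image `B_D(W) = {V^⊥ ∩ W : V ∈ S_D}` of the cell `S_D = S_{M(D)}`. -/
def LeDiagram.image {k n : ℕ} (D : LeDiagram k n) (W : Submodule ℝ (EuclideanSpace ℝ (Fin n))) :
    Set (Submodule ℝ (EuclideanSpace ℝ (Fin n))) :=
  {X | ∃ V ∈ positiveCell k n D.positroid, X = Vᗮ ⊓ W}

/-- A set of subspaces of `ℝⁿ`, as a subset of a normed space: the Grassmannians are embedded by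
sending a subspace to its orthogonal projection. -/
noncomputable def projections {n : ℕ} (B : Set (Submodule ℝ (EuclideanSpace ℝ (Fin n)))) :
    Set (EuclideanSpace ℝ (Fin n) →L[ℝ] EuclideanSpace ℝ (Fin n)) :=
  (fun X => X.starProjection) '' B

/-- A set `B` of subspaces of `ℝⁿ` has dimension `d`: it contains a homeomorphic copy of `ℝᵈ` (so it
is not empty), and its Hausdorff dimension is `d`. The first condition bounds the topological
dimension below by `d`, the second one bounds it above by `d`, so that `B` has dimension `d` in
every usual sense. -/
def HasDimension {n : ℕ} (B : Set (Submodule ℝ (EuclideanSpace ℝ (Fin n)))) (d : ℕ) : Prop :=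
  (∃ f : EuclideanSpace ℝ (Fin d) → (EuclideanSpace ℝ (Fin n) →L[ℝ] EuclideanSpace ℝ (Fin n)),
    Topology.IsEmbedding f ∧ Set.range f ⊆ projections B) ∧
  dimH (projections B) = d

/-! ### Maximal minors and the Cauchy–Binet formula -/

open Matrix

/-! Let `Z` be the set of labels of the rows without `+`. Describing perfect orientations by the
families of disjoint paths that they reverse (`mem_positroid_iff`) shows that `Z` is exactly the set
of labels lying in every basis of `M(D)`: a row without `+` emits no path, the empty family omits
every column label, and a single path omits the label of a row with a `+`. Let `j` be the smallest
label outside `Z`, and let `A` represent a point `V` of the cell and `C` the space `W`.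

Every basis contains all labels below `j`. Hence, if the unit vector `e_j` is adjoined to `A` as a
first row, the nonzero maximal minors of the new matrix all have sign `(-1)^j`, and by Cauchy–Binet
its product with `Cᵀ` is invertible (`HasCell.det_consUnitRow_ne_zero`). So a vector of `Vᗮ ⊓ W`
with vanishing coordinate `j` is zero. As `Vᗮ ⊓ W` has dimension at least `1`, it is a line with a
unique spanning vector of `j`-th coordinate `1`. The coordinates in `Z` vanish on `Vᗮ`
(`HasCell.coord_eq_zero`), so these spanning vectors all lie in one affine space `w₀ + K`, where `K`
consists of the vectors of `W` whose coordinates in `Z ∪ {j}` vanish. Since the Plücker coordinates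
of `W` are nonzero, `K` has dimension `(k + 1) - (|Z| + 1) = d` (`finrank_inf_coordKer`).

Conversely, the spanning vectors fill a neighbourhood in this affine space. A generic point of the
cell gives a `w₀` whose coordinates outside `Z` are all nonzero (`HasCell.exists_generic`). Any
nearby vector of `w₀ + K` has the same signs, and a positive rescaling of the columns of `A`, which
preserves the cell, makes the row space orthogonal to it (`HasCell.exists_of_sign`). The affine
chart then transfers the dimension to projections (`hasDimension_of_lines`).

All this needs the cell to be nonempty (`exists_hasCell`). A matrix is built box by box: a corner
box with a `+` corresponds to adding one column to its left neighbour, a corner box with a `0` to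
exchanging two adjacent columns up to sign. -/

theorem plucker_cauchyBinet {m n : ℕ} (A B : Matrix (Fin m) (Fin n) ℝ) :
    (A * Bᵀ).det = ∑ J, plucker A J * plucker B J := by
  have h1 : (A * Bᵀ).det =
      ∑ f : Fin m → Fin n, (∏ i, A i (f i)) * (Bᵀ.submatrix f id).det := by
    have : A * Bᵀ = fun i => ∑ l, A i l • Bᵀ l := by
      ext i j
      simp [Matrix.mul_apply, Finset.sum_apply]
    rw [this]
    change (detRowAlternating (n := Fin m) (R := ℝ)).toMultilinearMap _ = _
    rw [MultilinearMap.map_sum]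
    refine Finset.sum_congr rfl fun f _ => ?_
    rw [MultilinearMap.map_smul_univ]
    rfl
  have h2 : ∀ J : {J : Finset (Fin n) // J.card = m}, plucker A J * plucker B J =
      ∑ σ : Equiv.Perm (Fin m), (∏ i, A i (J.1.orderEmbOfFin J.2 (σ i))) *
        (Bᵀ.submatrix (J.1.orderEmbOfFin J.2 ∘ σ) id).det := by
    intro J
    have hB : ∀ σ : Equiv.Perm (Fin m), (Bᵀ.submatrix (J.1.orderEmbOfFin J.2 ∘ σ) id).det =
        Equiv.Perm.sign σ * plucker B J := by
      intro σ
      have := Matrix.det_permute σ (Bᵀ.submatrix (J.1.orderEmbOfFin J.2) id)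
      rw [plucker, ← Matrix.det_transpose (B.submatrix _ _)]
      exact this
    simp_rw [hB]
    rw [plucker, ← Matrix.det_transpose (A.submatrix _ _), Matrix.det_apply, Finset.sum_mul]
    refine Finset.sum_congr rfl fun σ _ => ?_
    simp only [transpose_apply, submatrix_apply, id, Units.smul_def, zsmul_eq_mul]
    ring
  rw [h1]
  simp_rw [h2]
  rw [← Fintype.sum_prod_type']
  symm
  -- An injective `f` is uniquely the increasing enumeration of its image `J` composed with a
  -- permutation; a non-injective `f` contributes a determinant with two equal rows.
  refine Finset.sum_of_injOn (fun x => x.1.1.orderEmbOfFin x.1.2 ∘ x.2) ?_ (by simp) ?_ ?_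
  · rintro ⟨J, σ⟩ - ⟨J', σ'⟩ - h
    have hr : ∀ (J : {J : Finset (Fin n) // J.card = m}) (σ : Equiv.Perm (Fin m)),
        Set.range (J.1.orderEmbOfFin J.2 ∘ σ) = J.1 := by
      intro J σ
      rw [σ.surjective.range_comp, Finset.range_orderEmbOfFin]
    have hJ : J = J' := by
      apply Subtype.ext
      apply Finset.coe_injective
      rw [← hr J σ, ← hr J' σ']
      exact congrArg _ h
    subst hJ
    congr 1
    ext i
    have := congrFun h i
    simpa [Fin.ext_iff] using this
  · intro f _ hf
    by_cases hi : Function.Injective f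
    · exfalso
      apply hf
      have hc : (Finset.univ.image f).card = m := by
        rw [Finset.card_image_of_injective _ hi]; simp
      let τ : Fin m → Fin m := fun i =>
        ((Finset.univ.image f).orderIsoOfFin hc).symm ⟨f i, by simp⟩
      have hτ : Function.Injective τ := by
        intro a b hab
        have := ((Finset.univ.image f).orderIsoOfFin hc).symm.injective hab
        exact hi (by simpa using this)
      refine ⟨(⟨_, hc⟩, Equiv.ofBijective τ (Finite.injective_iff_bijective.1 hτ)), by simp, ?_⟩
      ext i
      simp [τ, ← Finset.coe_orderIsoOfFin_apply]
    · simp only [Function.Injective, not_forall] at hi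
      obtain ⟨a, b, hab, hne⟩ := hi
      rw [Matrix.det_zero_of_row_eq hne, mul_zero]
      ext x
      simp [hab]
  · intro x _
    rfl

/-- The effect of rescaling the columns on the maximal minors. -/
theorem plucker_mul_diagonal {m n : ℕ} (A : Matrix (Fin m) (Fin n) ℝ) (t : Fin n → ℝ) (J) :
    plucker (A * diagonal t) J = (∏ i ∈ J.1, t i) * plucker A J := by
  have : (A * diagonal t).submatrix id (J.1.orderEmbOfFin J.2) =
      A.submatrix id (J.1.orderEmbOfFin J.2) * diagonal (t ∘ J.1.orderEmbOfFin J.2) := by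
    ext i j
    simp
  rw [plucker, this, Matrix.det_mul, Matrix.det_diagonal, mul_comm, plucker]
  congr 1
  conv_rhs => rw [← J.1.image_orderEmbOfFin_univ J.2]
  rw [Finset.prod_image (by simpa using (J.1.orderEmbOfFin J.2).injective)]
  rfl

theorem plucker_linearIndependent {m n : ℕ} {A : Matrix (Fin m) (Fin n) ℝ} {J}
    (h : plucker A J ≠ 0) : LinearIndependent ℝ fun i => (WithLp.toLp 2 (A i) : EuclideanSpace ℝ (Fin n)) := by
  have h1 : LinearIndependent ℝ (A.submatrix id (J.1.orderEmbOfFin J.2)).row :=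
    Matrix.linearIndependent_rows_of_det_ne_zero h
  let L : EuclideanSpace ℝ (Fin n) →ₗ[ℝ] (Fin m → ℝ) :=
    LinearMap.pi fun i => (EuclideanSpace.proj (J.1.orderEmbOfFin J.2 i) : _ →L[ℝ] ℝ).toLinearMap
  refine LinearIndependent.of_comp L ?_
  exact h1

theorem represents_span {m n : ℕ} {A : Matrix (Fin m) (Fin n) ℝ} {J} (h : plucker A J ≠ 0) :
    Represents A (Submodule.span ℝ (Set.range fun i => WithLp.toLp 2 (A i))) :=
  ⟨by rw [finrank_span_eq_card (plucker_linearIndependent h)]; simp, rfl⟩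

/-! ### Maximal minors under operations on adjacent columns -/

/-- Exchanging two adjacent labels, exactly one of which is in `J`. -/
theorem orderEmbOfFin_swap {m n : ℕ} {J J' : Finset (Fin n)} (hJ : J.card = m) (hJ' : J'.card = m)
    {i j : Fin n} (hij : (j : ℕ) = i + 1) (hne : i ∉ J ∨ j ∉ J)
    (h : ∀ x, x ∈ J' ↔ Equiv.swap i j x ∈ J) :
    Equiv.swap i j ∘ J.orderEmbOfFin hJ = J'.orderEmbOfFin hJ' := by
  refine Finset.orderEmbOfFin_unique hJ' (fun x => ?_) (fun a b hab => ?_)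
  · rw [h]; simp
  · have h1 : J.orderEmbOfFin hJ a < J.orderEmbOfFin hJ b := by simpa
    have ha := J.orderEmbOfFin_mem hJ a
    have hb := J.orderEmbOfFin_mem hJ b
    simp only [Function.comp_apply, Equiv.swap_apply_def]
    generalize J.orderEmbOfFin hJ a = x at *
    generalize J.orderEmbOfFin hJ b = y at *
    have : ¬ (x = i ∧ y = j) := by
      rintro ⟨rfl, rfl⟩
      tauto
    simp only [Fin.ext_iff, Fin.lt_def] at *
    split_ifs <;> omega

theorem plucker_addCol_of_notMem {m n : ℕ} (A : Matrix (Fin m) (Fin n) ℝ) {i : Fin n}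
    (v : Fin m → ℝ) {J} (hi : i ∉ J.1) : plucker (A.updateCol i v) J = plucker A J := by
  rw [plucker, plucker]
  congr 1
  ext a b
  rw [submatrix_apply, submatrix_apply, updateCol_ne]
  rintro h
  exact hi (h ▸ J.1.orderEmbOfFin_mem J.2 b)

theorem exists_orderEmbOfFin_eq {m n : ℕ} {J : Finset (Fin n)} (hJ : J.card = m) {i : Fin n}
    (hi : i ∈ J) : ∃ p, J.orderEmbOfFin hJ p = i := by
  have : i ∈ Set.range (J.orderEmbOfFin hJ) := by simpa using hi
  exact this

theorem submatrix_updateCol_orderEmbOfFin {m n : ℕ} (A : Matrix (Fin m) (Fin n) ℝ) {J : Finset (Fin n)}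
    (hJ : J.card = m) (p : Fin m) (v : Fin m → ℝ) :
    (A.updateCol (J.orderEmbOfFin hJ p) v).submatrix id (J.orderEmbOfFin hJ) =
      (A.submatrix id (J.orderEmbOfFin hJ)).updateCol p v := by
  ext a b
  simp [updateCol_apply]

theorem plucker_addCol_of_mem {m n : ℕ} (A : Matrix (Fin m) (Fin n) ℝ) {i j : Fin n} (hij : i ≠ j)
    {J} (hi : i ∈ J.1) (hj : j ∈ J.1) :
    plucker (A.updateCol i fun r => A r i + A r j) J = plucker A J := by
  obtain ⟨p, rfl⟩ := exists_orderEmbOfFin_eq J.2 hi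
  obtain ⟨q, rfl⟩ := exists_orderEmbOfFin_eq J.2 hj
  rw [plucker, submatrix_updateCol_orderEmbOfFin]
  exact Matrix.det_updateCol_add_self _ (i := p) (j := q) (by rintro rfl; exact hij rfl)

/-- Multilinearity in column `i`. Replacing `i` by its neighbour `j` leaves the columns in
increasing order, so the second minor appears without a sign. -/
theorem plucker_addCol_of_mem_notMem {m n : ℕ} (A : Matrix (Fin m) (Fin n) ℝ) {i j : Fin n}
    (hij : (j : ℕ) = i + 1) {J J' : {J : Finset (Fin n) // J.card = m}} (hi : i ∈ J.1) (hj : j ∉ J.1)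
    (h : ∀ x, x ∈ J'.1 ↔ Equiv.swap i j x ∈ J.1) :
    plucker (A.updateCol i fun r => A r i + A r j) J = plucker A J + plucker A J' := by
  have hs := orderEmbOfFin_swap J.2 J'.2 hij (Or.inr hj) h
  obtain ⟨p, hp⟩ := exists_orderEmbOfFin_eq J.2 hi
  have e : (A.updateCol i fun r => A r i + A r j).submatrix id (J.1.orderEmbOfFin J.2) =
      (A.submatrix id (J.1.orderEmbOfFin J.2)).updateCol p ((fun r => A r i) + fun r => A r j) := by
    conv_lhs => rw [← hp]
    rw [submatrix_updateCol_orderEmbOfFin, hp]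
    rfl
  rw [plucker, e, det_updateCol_add, plucker, plucker, ← hs]
  congr 2
  · ext a b
    rw [updateCol_apply]
    split_ifs with hb
    · simp [hb, hp]
    · rfl
  · ext a b
    rw [updateCol_apply]
    split_ifs with hb
    · simp [hb, hp]
    · have h1 : J.1.orderEmbOfFin J.2 b ≠ i := by
        rw [← hp]; simpa using hb
      have h2 : J.1.orderEmbOfFin J.2 b ≠ j := by
        rintro rfl; exact hj (J.1.orderEmbOfFin_mem J.2 b)
      simp [Equiv.swap_apply_of_ne_of_ne h1 h2]

theorem plucker_swapCol {m n : ℕ} (A : Matrix (Fin m) (Fin n) ℝ) {i j : Fin n}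
    (hij : (j : ℕ) = i + 1) {J J' : {J : Finset (Fin n) // J.card = m}} (hne : i ∉ J.1 ∨ j ∉ J.1)
    (h : ∀ x, x ∈ J'.1 ↔ Equiv.swap i j x ∈ J.1) :
    plucker (A.submatrix id (Equiv.swap i j)) J = plucker A J' := by
  rw [plucker, plucker, ← orderEmbOfFin_swap J.2 J'.2 hij hne h]
  rfl

theorem plucker_swapCol_of_mem {m n : ℕ} (A : Matrix (Fin m) (Fin n) ℝ) {i j : Fin n} (hij : i ≠ j)
    {J} (hi : i ∈ J.1) (hj : j ∈ J.1) :
    plucker (A.submatrix id (Equiv.swap i j)) J = - plucker A J := by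
  obtain ⟨p, rfl⟩ := exists_orderEmbOfFin_eq J.2 hi
  obtain ⟨q, rfl⟩ := exists_orderEmbOfFin_eq J.2 hj
  have hpq : p ≠ q := by rintro rfl; exact hij rfl
  have : (A.submatrix id (Equiv.swap (J.1.orderEmbOfFin J.2 p) (J.1.orderEmbOfFin J.2 q))).submatrix
      id (J.1.orderEmbOfFin J.2) =
      (A.submatrix id (J.1.orderEmbOfFin J.2)).submatrix id (Equiv.swap p q) := by
    ext a b
    simp only [submatrix_apply, id]
    congr 1
    simp only [Equiv.swap_apply_def, EmbeddingLike.apply_eq_iff_eq]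
    split_ifs <;> rfl
  rw [plucker, this, Matrix.det_permute', Equiv.Perm.sign_swap hpq, plucker]
  simp

/-! ### Adjoining a unit vector as a row -/

theorem card_filter_lt_orderEmbOfFin {m n : ℕ} {J : Finset (Fin n)} (hJ : J.card = m) (p : Fin m) :
    (J.filter (· < J.orderEmbOfFin hJ p)).card = p := by
  have : J.filter (· < J.orderEmbOfFin hJ p) =
      (Finset.Iio p).map (J.orderEmbOfFin hJ).toEmbedding := by
    ext x
    simp only [Finset.mem_filter, Finset.mem_map, Finset.mem_Iio]
    constructor
    · rintro ⟨hx, hlt⟩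
      obtain ⟨q, rfl⟩ := exists_orderEmbOfFin_eq hJ hx
      exact ⟨q, by simpa using hlt, rfl⟩
    · rintro ⟨q, hq, rfl⟩
      exact ⟨J.orderEmbOfFin_mem hJ q, by simpa using hq⟩
  rw [this]
  simp

/-- The matrix `A` with the unit vector `e_i` added as its first row. -/
def consUnitRow {m n : ℕ} (i : Fin n) (A : Matrix (Fin m) (Fin n) ℝ) :
    Matrix (Fin (m + 1)) (Fin n) ℝ :=
  of fun r l => Fin.cons (α := fun _ => ℝ) (if l = i then 1 else 0) (fun s => A s l) r

theorem consUnitRow_zero {m n : ℕ} (i : Fin n) (A : Matrix (Fin m) (Fin n) ℝ) (l : Fin n) :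
    consUnitRow i A 0 l = if l = i then 1 else 0 := rfl

theorem plucker_consUnitRow_of_notMem {m n : ℕ} (i : Fin n) (A : Matrix (Fin m) (Fin n) ℝ) {J}
    (hi : i ∉ J.1) : plucker (consUnitRow i A) J = 0 := by
  refine Matrix.det_eq_zero_of_row_eq_zero 0 fun b => ?_
  rw [submatrix_apply, id, consUnitRow_zero, if_neg]
  rintro rfl
  exact hi (J.1.orderEmbOfFin_mem J.2 b)

/-- Laplace expansion along the first row; the sign is the position of `i` in `J`, expressed by
counting the smaller elements of `I`. -/
theorem plucker_consUnitRow_of_mem {m n : ℕ} {i : Fin n} (A : Matrix (Fin m) (Fin n) ℝ)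
    {J : {J : Finset (Fin n) // J.card = m + 1}} {I : {I : Finset (Fin n) // I.card = m}}
    (hi : i ∈ J.1) (hI : I.1 = J.1.erase i) :
    plucker (consUnitRow i A) J = (-1) ^ (I.1.filter (· < i)).card * plucker A I := by
  obtain ⟨p, hp⟩ := exists_orderEmbOfFin_eq J.2 hi
  have hcard : (I.1.filter (· < i)).card = p := by
    rw [← card_filter_lt_orderEmbOfFin J.2 p, hp, hI]
    congr 1
    ext x
    simp only [Finset.mem_filter, Finset.mem_erase]
    constructor
    · tauto
    · rintro ⟨h1, h2⟩
      exact ⟨⟨h2.ne, h1⟩, h2⟩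
  have he : J.1.orderEmbOfFin J.2 ∘ p.succAbove = I.1.orderEmbOfFin I.2 := by
    refine Finset.orderEmbOfFin_unique I.2 (fun x => ?_) ?_
    · rw [hI, Finset.mem_erase]
      refine ⟨?_, J.1.orderEmbOfFin_mem J.2 _⟩
      rw [← hp]
      simp
    · exact (J.1.orderEmbOfFin J.2).strictMono.comp (Fin.strictMono_succAbove p)
  rw [plucker, det_succ_row_zero, Finset.sum_eq_single p]
  · rw [hcard, plucker, ← he]
    rw [submatrix_apply, id, hp, consUnitRow_zero, if_pos rfl, mul_one]
    rfl
  · intro q _ hq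
    rw [submatrix_apply, id, consUnitRow_zero, if_neg]
    · simp
    · rw [← hp]; simpa using hq
  · simp

/-! ### Border labels -/

namespace LeDiagram

variable {k n : ℕ}

theorem rowLabel_strictMono (D : LeDiagram k n) : StrictMono D.rowLabel := by
  intro r r' h
  have h1 := D.shape.rowLen_anti r r' (le_of_lt h)
  simp only [rowLabel, Fin.lt_def] at *
  omega

theorem colLabel_strictAnti (D : LeDiagram k n) : StrictAnti D.colLabel := by
  intro c c' h
  have h1 := D.shape.colLen_anti c c' (le_of_lt h)
  have := c'.2
  simp only [colLabel, Fin.lt_def] at *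
  omega

/-- Along the border, the step of row `r` comes before that of column `c` exactly when the box `(r,
c)` belongs to the shape. -/
theorem rowLabel_ne_colLabel (D : LeDiagram k n) (r : Fin k) (c : Fin (n - k)) :
    D.rowLabel r ≠ D.colLabel c := by
  have h1 : (c : ℕ) < D.shape.rowLen r ↔ (r : ℕ) < D.shape.colLen c := by
    rw [← YoungDiagram.mem_iff_lt_rowLen, YoungDiagram.mem_iff_lt_colLen]
  have := r.2
  have := c.2
  simp only [rowLabel, colLabel, ne_eq, Fin.ext_iff]
  omega

theorem exists_label (D : LeDiagram k n) (i : Fin n) :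
    (∃ r, D.rowLabel r = i) ∨ ∃ c, D.colLabel c = i := by
  have hinj : Function.Injective (Sum.elim D.rowLabel D.colLabel) :=
    D.rowLabel_strictMono.injective.sumElim D.colLabel_strictAnti.injective D.rowLabel_ne_colLabel
  have hbij := (Fintype.bijective_iff_injective_and_card _).2 ⟨hinj, by
    have := D.k_le
    simp only [Fintype.card_sum, Fintype.card_fin]
    omega⟩
  obtain ⟨x | x, hx⟩ := hbij.2 i
  · exact Or.inl ⟨x, hx⟩
  · exact Or.inr ⟨x, hx⟩

/-! ### Flows in the network of a Le-diagram -/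

/-- The box in row `r` and column `c` holds a `+`. -/
def HasPlus (D : LeDiagram k n) (r c : ℕ) : Prop := ∃ p ∈ D.plus, (p.1 : ℕ) = r ∧ (p.2 : ℕ) = c

theorem hasPlus_iff (D : LeDiagram k n) (r : Fin k) (c : Fin (n - k)) :
    D.HasPlus r c ↔ (r, c) ∈ D.plus := by
  constructor
  · rintro ⟨⟨r', c'⟩, hp, h1, h2⟩
    rwa [← Fin.ext h1, ← Fin.ext h2]
  · intro h
    exact ⟨_, h, rfl, rfl⟩

/-- A family of vertex-disjoint directed paths in the network of `D`: `H r c` says that a path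
crosses the left side of the box `(r, c)`, and `V r c` that a path crosses its top side. -/
structure IsFlow (D : LeDiagram k n) (H V : ℕ → ℕ → Prop) : Prop where
  left : ∀ r, ¬ H r 0
  top : ∀ c, ¬ V 0 c
  pass_h : ∀ r c, ¬ D.HasPlus r c → (H r (c + 1) ↔ H r c)
  pass_v : ∀ r c, ¬ D.HasPlus r c → (V (r + 1) c ↔ V r c)
  plus : ∀ r c, D.HasPlus r c → ¬ (H r (c + 1) ∧ V r c) ∧ ¬ (H r c ∧ V (r + 1) c) ∧
    ((H r (c + 1) ∨ V r c) ↔ (H r c ∨ V (r + 1) c))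

/-- The labels of the rows in which no path starts and of the columns in which a path ends. -/
def flowSources (D : LeDiagram k n) (H V : ℕ → ℕ → Prop) : Set (Fin n) :=
  {i | (∃ r : Fin k, D.rowLabel r = i ∧ ¬ H r (n - k)) ∨
    ∃ c : Fin (n - k), D.colLabel c = i ∧ V k c}

theorem rowLabel_mem_flowSources (D : LeDiagram k n) {H V : ℕ → ℕ → Prop} (r : Fin k) :
    D.rowLabel r ∈ D.flowSources H V ↔ ¬ H r (n - k) := by
  constructor
  · rintro (⟨r', h, h'⟩ | ⟨c, h, -⟩)
    · rwa [← D.rowLabel_strictMono.injective h]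
    · exact absurd h.symm (D.rowLabel_ne_colLabel r c)
  · intro h
    exact Or.inl ⟨r, rfl, h⟩

theorem colLabel_mem_flowSources (D : LeDiagram k n) {H V : ℕ → ℕ → Prop} (c : Fin (n - k)) :
    D.colLabel c ∈ D.flowSources H V ↔ V k c := by
  constructor
  · rintro (⟨r, h, -⟩ | ⟨c', h, h'⟩)
    · exact absurd h (D.rowLabel_ne_colLabel r c)
    · rwa [← D.colLabel_strictAnti.injective h]
  · intro h
    exact Or.inr ⟨c, rfl, h⟩

theorem iff_of_pass {f P : ℕ → Prop} (h : ∀ c, ¬ P c → (f (c + 1) ↔ f c)) {a b : ℕ} (hab : a ≤ b)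
    (hP : ∀ c, a ≤ c → c < b → ¬ P c) : f b ↔ f a := by
  induction b, hab using Nat.le_induction with
  | base => rfl
  | succ b hb ih =>
    rw [h b (hP b hb (Nat.lt_succ_self b)), ih fun c h1 h2 => hP c h1 (by omega)]

/-- `carry P e c` is the value of `e` at the last place before `c` at which `P` holds. -/
def carry (P e : ℕ → Prop) : ℕ → Prop
  | 0 => False
  | c + 1 => (P c ∧ e c) ∨ (¬ P c ∧ carry P e c)

theorem carry_iff (P e : ℕ → Prop) (c : ℕ) :
    carry P e c ↔ ∃ c', c' < c ∧ P c' ∧ e c' ∧ ∀ c'', c' < c'' → c'' < c → ¬ P c'' := by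
  induction c with
  | zero => simp [carry]
  | succ c ih =>
    rw [carry, ih]
    constructor
    · rintro (⟨h1, h2⟩ | ⟨h, c', h1, h2, h3, h4⟩)
      · exact ⟨c, by omega, h1, h2, fun _ _ _ => by omega⟩
      · refine ⟨c', by omega, h2, h3, fun c'' h5 h6 => ?_⟩
        rcases (by omega : c'' < c ∨ c'' = c) with h7 | rfl
        · exact h4 _ h5 h7
        · exact h
    · rintro ⟨c', h1, h2, h3, h4⟩
      rcases (by omega : c' < c ∨ c' = c) with h7 | rfl
      · exact Or.inr ⟨h4 _ h7 (by omega), c', h7, h2, h3, fun c'' h5 h6 => h4 _ h5 (by omega)⟩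
      · exact Or.inl ⟨h2, h3⟩

/-! ### Local structure of the plabic graph -/

/-- `x` is the end of the edge going east from the `+` in the box `(r, c)`. -/
def EastOf (D : LeDiagram k n) (r : Fin k) (c : Fin (n - k)) (x : Fin n ⊕ D.Vertex) : Prop :=
  (x = .inl (D.rowLabel r) ∧ ∀ c', c < c' → (r, c') ∉ D.plus) ∨
  ∃ c' hp', c < c' ∧ (∀ c'', c < c'' → c'' < c' → (r, c'') ∉ D.plus) ∧
    x = .inr (.white (r, c') hp')

/-- `x` is the end of the edge going north from the `+` in the box `(r, c)`. -/
def NorthOf (D : LeDiagram k n) (r : Fin k) (c : Fin (n - k)) (x : Fin n ⊕ D.Vertex) : Prop :=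
  ∃ r' hp', r' < r ∧ (∀ r'', r' < r'' → r'' < r → (r'', c) ∉ D.plus) ∧
    x = .inr (.white (r', c) hp')

/-- `x` is the end of the edge going west from the `+` in the box `(r, c)`. -/
def WestOf (D : LeDiagram k n) (r : Fin k) (c : Fin (n - k)) (x : Fin n ⊕ D.Vertex) : Prop :=
  ∃ c' hp', c' < c ∧ (∀ c'', c' < c'' → c'' < c → (r, c'') ∉ D.plus) ∧
    x = .inr (.black (r, c') hp')

/-- `x` is the end of the edge going south from the `+` in the box `(r, c)`. -/
def SouthOf (D : LeDiagram k n) (r : Fin k) (c : Fin (n - k)) (x : Fin n ⊕ D.Vertex) : Prop :=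
  (x = .inl (D.colLabel c) ∧ ∀ r', r < r' → (r', c) ∉ D.plus) ∨
  ∃ r' hp', r < r' ∧ (∀ r'', r < r'' → r'' < r' → (r'', c) ∉ D.plus) ∧
    x = .inr (.black (r', c) hp')

/-- `x` is the internal vertex joined to the boundary vertex of row `r`. -/
def RowEnd (D : LeDiagram k n) (r : Fin k) (x : Fin n ⊕ D.Vertex) : Prop :=
  (∃ c hp, (∀ c', c < c' → (r, c') ∉ D.plus) ∧ x = .inr (.black (r, c) hp)) ∨
  ∃ hr, x = .inr (.whiteLeaf r hr)

/-- `x` is the internal vertex joined to the boundary vertex of column `c`. -/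
def ColEnd (D : LeDiagram k n) (c : Fin (n - k)) (x : Fin n ⊕ D.Vertex) : Prop :=
  (∃ r hp, (∀ r', r < r' → (r', c) ∉ D.plus) ∧ x = .inr (.white (r, c) hp)) ∨
  ∃ hc, x = .inr (.blackLeaf c hc)

section Arcs

variable {D : LeDiagram k n} {r : Fin k} {c : Fin (n - k)} {x : Fin n ⊕ D.Vertex}

theorem arc_black_iff (hp : (r, c) ∈ D.plus) :
    D.Arc (.inr (.black (r, c) hp)) x ↔ x = .inr (.white (r, c) hp) := by
  constructor
  · intro h; cases h; rfl
  · rintro rfl; exact .middle _ _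

theorem arc_to_white_iff (hp : (r, c) ∈ D.plus) :
    D.Arc x (.inr (.white (r, c) hp)) ↔ x = .inr (.black (r, c) hp) := by
  constructor
  · intro h; cases h; rfl
  · rintro rfl; exact .middle _ _

theorem arc_to_black_iff (hp : (r, c) ∈ D.plus) :
    D.Arc x (.inr (.black (r, c) hp)) ↔ D.EastOf r c x ∨ D.NorthOf r c x := by
  constructor
  · intro h
    cases h with
    | left _ _ c' _ hp' hlt hnext => exact Or.inl (Or.inr ⟨c', hp', hlt, hnext, rfl⟩)
    | down r' _ _ hp' _ hlt hnext => exact Or.inr ⟨r', hp', hlt, hnext, rfl⟩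
    | enter _ _ _ hlast => exact Or.inl (Or.inl ⟨rfl, hlast⟩)
  · rintro ((⟨rfl, h⟩ | ⟨c', hp', h1, h2, rfl⟩) | ⟨r', hp', h1, h2, rfl⟩)
    · exact .enter _ _ _ h
    · exact .left _ _ _ _ _ h1 h2
    · exact .down _ _ _ _ _ h1 h2

theorem arc_white_iff (hp : (r, c) ∈ D.plus) :
    D.Arc (.inr (.white (r, c) hp)) x ↔ D.WestOf r c x ∨ D.SouthOf r c x := by
  constructor
  · intro h
    cases h with
    | left _ c' _ hp' _ hlt hnext => exact Or.inl ⟨c', hp', hlt, hnext, rfl⟩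
    | down _ r' _ _ hp' hlt hnext => exact Or.inr (Or.inr ⟨r', hp', hlt, hnext, rfl⟩)
    | exit _ _ _ hlast => exact Or.inr (Or.inl ⟨rfl, hlast⟩)
  · rintro (⟨c', hp', h1, h2, rfl⟩ | (⟨rfl, h⟩ | ⟨r', hp', h1, h2, rfl⟩))
    · exact .left _ _ _ _ _ h1 h2
    · exact .exit _ _ _ h
    · exact .down _ _ _ _ _ h1 h2

theorem arc_rowLabel_iff : D.Arc (.inl (D.rowLabel r)) x ↔ D.RowEnd r x := by
  constructor
  · intro h
    generalize hy : (Sum.inl (D.rowLabel r) : Fin n ⊕ D.Vertex) = y at h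
    cases h with
    | enter r' c hp hlast =>
      obtain rfl := D.rowLabel_strictMono.injective (Sum.inl_injective hy)
      exact Or.inl ⟨c, hp, hlast, rfl⟩
    | whiteLollipop r' hr =>
      obtain rfl := D.rowLabel_strictMono.injective (Sum.inl_injective hy)
      exact Or.inr ⟨hr, rfl⟩
    | _ => exact absurd hy (by simp)
  · rintro (⟨c, hp, h, rfl⟩ | ⟨hr, rfl⟩)
    · exact .enter _ _ _ h
    · exact .whiteLollipop _ _

theorem not_arc_to_rowLabel : ¬ D.Arc x (.inl (D.rowLabel r)) := by
  intro h
  generalize hy : (Sum.inl (D.rowLabel r) : Fin n ⊕ D.Vertex) = y at h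
  cases h with
  | exit r' c hp hlast => exact D.rowLabel_ne_colLabel _ _ (Sum.inl_injective hy)
  | blackLollipop c hc => exact D.rowLabel_ne_colLabel _ _ (Sum.inl_injective hy)
  | _ => exact absurd hy (by simp)

theorem arc_to_colLabel_iff : D.Arc x (.inl (D.colLabel c)) ↔ D.ColEnd c x := by
  constructor
  · intro h
    generalize hy : (Sum.inl (D.colLabel c) : Fin n ⊕ D.Vertex) = y at h
    cases h with
    | exit r c' hp hlast =>
      obtain rfl := D.colLabel_strictAnti.injective (Sum.inl_injective hy)
      exact Or.inl ⟨r, hp, hlast, rfl⟩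
    | blackLollipop c' hc =>
      obtain rfl := D.colLabel_strictAnti.injective (Sum.inl_injective hy)
      exact Or.inr ⟨hc, rfl⟩
    | _ => exact absurd hy (by simp)
  · rintro (⟨c, hp, h, rfl⟩ | ⟨hr, rfl⟩)
    · exact .exit _ _ _ h
    · exact .blackLollipop _ _

theorem not_arc_colLabel : ¬ D.Arc (.inl (D.colLabel c)) x := by
  intro h
  generalize hy : (Sum.inl (D.colLabel c) : Fin n ⊕ D.Vertex) = y at h
  cases h with
  | enter r' c' hp hlast => exact D.rowLabel_ne_colLabel _ _ (Sum.inl_injective hy).symm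
  | whiteLollipop r' hr => exact D.rowLabel_ne_colLabel _ _ (Sum.inl_injective hy).symm
  | _ => exact absurd hy (by simp)

theorem arc_to_whiteLeaf_iff (hr : ∀ c, (r, c) ∉ D.plus) :
    D.Arc x (.inr (.whiteLeaf r hr)) ↔ x = .inl (D.rowLabel r) := by
  constructor
  · intro h; cases h; rfl
  · rintro rfl; exact .whiteLollipop _ _

theorem not_arc_whiteLeaf (hr : ∀ c, (r, c) ∉ D.plus) : ¬ D.Arc (.inr (.whiteLeaf r hr)) x := by
  intro h; cases h

theorem arc_blackLeaf_iff (hc : ∀ r, (r, c) ∉ D.plus) :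
    D.Arc (.inr (.blackLeaf c hc)) x ↔ x = .inl (D.colLabel c) := by
  constructor
  · intro h; cases h; rfl
  · rintro rfl; exact .blackLollipop _ _

theorem not_arc_to_blackLeaf (hc : ∀ r, (r, c) ∉ D.plus) : ¬ D.Arc x (.inr (.blackLeaf c hc)) := by
  intro h; cases h

theorem arc_asymm {y : Fin n ⊕ D.Vertex} (h : D.Arc x y) : ¬ D.Arc y x := by
  cases h with
  | middle p hp => rintro h'; cases h' <;> exact lt_irrefl _ ‹_›
  | left r c c' hp hp' hlt hnext => rintro h'; cases h'; exact lt_irrefl _ hlt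
  | down r r' c hp hp' hlt hnext => rintro h'; cases h'; exact lt_irrefl _ hlt
  | enter r c hp hlast => exact not_arc_to_rowLabel
  | exit r c hp hlast => exact not_arc_colLabel
  | whiteLollipop r hr => exact not_arc_to_rowLabel
  | blackLollipop c hc => exact not_arc_colLabel

theorem adj_iff {y : Fin n ⊕ D.Vertex} : D.plabicGraph.Adj x y ↔ D.Arc x y ∨ D.Arc y x := by
  rw [plabicGraph, SimpleGraph.fromRel_adj]
  constructor
  · exact fun h => h.2
  · refine fun h => ⟨?_, h⟩
    rintro rfl
    rcases h with h | h <;> exact arc_asymm h h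

theorem exists_eastOf (D : LeDiagram k n) (r : Fin k) (c : Fin (n - k)) : ∃ x, D.EastOf r c x := by
  by_cases h : ∀ c', c < c' → (r, c') ∉ D.plus
  · exact ⟨_, Or.inl ⟨rfl, h⟩⟩
  · push Not at h
    have hex : ∃ m : ℕ, ∃ h : m < n - k, c < ⟨m, h⟩ ∧ (r, ⟨m, h⟩) ∈ D.plus := by
      obtain ⟨c', h1, h2⟩ := h
      exact ⟨c', c'.2, h1, h2⟩
    classical
    obtain ⟨h1, h2, h3⟩ := Nat.find_spec hex
    refine ⟨_, Or.inr ⟨⟨_, h1⟩, h3, h2, fun c'' h4 h5 h6 => ?_, rfl⟩⟩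
    exact Nat.find_min hex (m := c'') h5 ⟨c''.2, h4, h6⟩

theorem exists_southOf (D : LeDiagram k n) (r : Fin k) (c : Fin (n - k)) :
    ∃ x, D.SouthOf r c x := by
  by_cases h : ∀ r', r < r' → (r', c) ∉ D.plus
  · exact ⟨_, Or.inl ⟨rfl, h⟩⟩
  · push Not at h
    have hex : ∃ m : ℕ, ∃ h : m < k, r < ⟨m, h⟩ ∧ (⟨m, h⟩, c) ∈ D.plus := by
      obtain ⟨c', h1, h2⟩ := h
      exact ⟨c', c'.2, h1, h2⟩
    classical
    obtain ⟨h1, h2, h3⟩ := Nat.find_spec hex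
    refine ⟨_, Or.inr ⟨⟨_, h1⟩, h3, h2, fun c'' h4 h5 h6 => ?_, rfl⟩⟩
    exact Nat.find_min hex (m := c'') h5 ⟨c''.2, h4, h6⟩

theorem EastOf.unique {y : Fin n ⊕ D.Vertex} (hx : D.EastOf r c x) (hy : D.EastOf r c y) :
    x = y := by
  rcases hx with ⟨rfl, h⟩ | ⟨c', hp', h1, h2, rfl⟩ <;>
    rcases hy with ⟨rfl, h'⟩ | ⟨c'', hp'', h1', h2', rfl⟩
  · rfl
  · exact absurd hp'' (h _ h1')
  · exact absurd hp' (h' _ h1)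
  · rcases lt_trichotomy c' c'' with h | rfl | h
    · exact absurd hp' (h2' _ h1 h)
    · rfl
    · exact absurd hp'' (h2 _ h1' h)

theorem SouthOf.unique {y : Fin n ⊕ D.Vertex} (hx : D.SouthOf r c x) (hy : D.SouthOf r c y) :
    x = y := by
  rcases hx with ⟨rfl, h⟩ | ⟨c', hp', h1, h2, rfl⟩ <;>
    rcases hy with ⟨rfl, h'⟩ | ⟨c'', hp'', h1', h2', rfl⟩
  · rfl
  · exact absurd hp'' (h _ h1')
  · exact absurd hp' (h' _ h1)
  · rcases lt_trichotomy c' c'' with h | rfl | h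
    · exact absurd hp' (h2' _ h1 h)
    · rfl
    · exact absurd hp'' (h2 _ h1' h)

theorem NorthOf.unique {y : Fin n ⊕ D.Vertex} (hx : D.NorthOf r c x) (hy : D.NorthOf r c y) :
    x = y := by
  obtain ⟨c', hp', h1, h2, rfl⟩ := hx
  obtain ⟨c'', hp'', h1', h2', rfl⟩ := hy
  rcases lt_trichotomy c' c'' with h | rfl | h
  · exact absurd hp'' (h2 _ h h1')
  · rfl
  · exact absurd hp' (h2' _ h h1)

theorem WestOf.unique {y : Fin n ⊕ D.Vertex} (hx : D.WestOf r c x) (hy : D.WestOf r c y) :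
    x = y := by
  obtain ⟨c', hp', h1, h2, rfl⟩ := hx
  obtain ⟨c'', hp'', h1', h2', rfl⟩ := hy
  rcases lt_trichotomy c' c'' with h | rfl | h
  · exact absurd hp'' (h2 _ h h1')
  · rfl
  · exact absurd hp' (h2' _ h h1)

theorem EastOf.not_northOf (hx : D.EastOf r c x) : ¬ D.NorthOf r c x := by
  rintro ⟨r', hp', h1, -, rfl⟩
  rcases hx with ⟨h, -⟩ | ⟨c', hp'', h2, -, h⟩
  · simp at h
  · simp only [Sum.inr.injEq, Vertex.white.injEq, Prod.mk.injEq] at h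
    exact h1.ne h.1

theorem SouthOf.not_westOf (hx : D.SouthOf r c x) : ¬ D.WestOf r c x := by
  rintro ⟨r', hp', h1, -, rfl⟩
  rcases hx with ⟨h, -⟩ | ⟨c', hp'', h2, -, h⟩
  · simp at h
  · simp only [Sum.inr.injEq, Vertex.black.injEq, Prod.mk.injEq] at h
    exact h1.ne h.2

end Arcs

/-! ### From flows to perfect orientations -/

section Flow

variable {D : LeDiagram k n} {H V : ℕ → ℕ → Prop}

theorem IsFlow.h_eq (hf : D.IsFlow H V) {r : Fin k} {a b : ℕ} (hab : a ≤ b)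
    (h : ∀ c : Fin (n - k), a ≤ c → c < b → (r, c) ∉ D.plus) : H r b ↔ H r a := by
  refine iff_of_pass (fun c => hf.pass_h r c) hab fun c h1 h2 => ?_
  rintro ⟨⟨r', c'⟩, h3, h4, rfl⟩
  obtain rfl := Fin.ext h4
  exact h c' h1 h2 h3

theorem IsFlow.v_eq (hf : D.IsFlow H V) {c : Fin (n - k)} {a b : ℕ} (hab : a ≤ b)
    (h : ∀ r : Fin k, a ≤ r → r < b → (r, c) ∉ D.plus) : V b c ↔ V a c := by
  refine iff_of_pass (f := fun r => V r c) (fun r => hf.pass_v r c) hab fun r h1 h2 => ?_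
  rintro ⟨⟨r', c'⟩, h3, rfl, h4⟩
  obtain rfl := Fin.ext h4
  exact h r' h1 h2 h3

/-- Without a `+` further left, the path would reach the left side of the rectangle, which `left`
forbids. -/
theorem IsFlow.westOf (hf : D.IsFlow H V) {r : Fin k} {c : Fin (n - k)} (h : H r c) :
    ∃ x, D.WestOf r c x := by
  by_contra hx
  have hno : ∀ c' : Fin (n - k), c' < c → (r, c') ∉ D.plus := by
    intro c' hc' hp'
    classical
    obtain ⟨c0, hc0, hmax⟩ := (Finset.univ.filter fun c' => c' < c ∧ (r, c') ∈ D.plus).exists_max_image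
      id ⟨c', by simp [hc', hp']⟩
    simp only [Finset.mem_filter, Finset.mem_univ, true_and, id] at hc0 hmax
    exact hx ⟨_, c0, hc0.2, hc0.1, fun c'' h1 h2 h3 => absurd (hmax c'' ⟨h2, h3⟩) (not_le.2 h1), rfl⟩
  have := (hf.h_eq (r := r) (Nat.zero_le c) fun c' _ h2 => hno c' h2).1 h
  exact hf.left r this

theorem IsFlow.northOf (hf : D.IsFlow H V) {r : Fin k} {c : Fin (n - k)} (h : V r c) :
    ∃ x, D.NorthOf r c x := by
  by_contra hx
  have hno : ∀ r' : Fin k, r' < r → (r', c) ∉ D.plus := by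
    intro c' hc' hp'
    classical
    obtain ⟨c0, hc0, hmax⟩ := (Finset.univ.filter fun c' => c' < r ∧ (c', c) ∈ D.plus).exists_max_image
      id ⟨c', by simp [hc', hp']⟩
    simp only [Finset.mem_filter, Finset.mem_univ, true_and, id] at hc0 hmax
    exact hx ⟨_, c0, hc0.2, hc0.1, fun c'' h1 h2 h3 => absurd (hmax c'' ⟨h2, h3⟩) (not_le.2 h1), rfl⟩
  have := (hf.v_eq (c := c) (Nat.zero_le r) fun c' _ h2 => hno c' h2).1 h
  exact hf.top c this

/-- The arcs used by the paths of a flow. -/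
def flowArc (D : LeDiagram k n) (H V : ℕ → ℕ → Prop) :
    Fin n ⊕ D.Vertex → Fin n ⊕ D.Vertex → Prop
  | .inl _, .inr (.black p _) => H p.1 (p.2 + 1)
  -- Only values on arcs matter: an arc from white to black is horizontal when both ends are in one
  -- row, vertical otherwise. Lollipops fall under the default `False`, since no path uses them.
  | .inr (.white p _), .inr (.black q _) =>
    (p.1 = q.1 ∧ H q.1 (q.2 + 1)) ∨ (p.1 ≠ q.1 ∧ V (p.1 + 1) p.2)
  | .inr (.white p _), .inl _ => V (p.1 + 1) p.2
  | .inr (.black p _), .inr (.white _ _) => H p.1 (p.2 + 1) ∨ V p.1 p.2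
  | _, _ => False

/-- The orientation obtained by reversing the paths of a flow. -/
def flowOrientation (D : LeDiagram k n) (H V : ℕ → ℕ → Prop) (x y : Fin n ⊕ D.Vertex) : Prop :=
  (D.Arc x y ∧ ¬ D.flowArc H V x y) ∨ (D.Arc y x ∧ D.flowArc H V y x)

theorem flowOrientation_black_iff (hf : D.IsFlow H V) {r c} (hp : (r, c) ∈ D.plus)
    (x : Fin n ⊕ D.Vertex) : D.flowOrientation H V (.inr (.black (r, c) hp)) x ↔
      (x = .inr (.white (r, c) hp) ∧ ¬ (H r (c + 1) ∨ V r c)) ∨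
      (D.EastOf r c x ∧ H r (c + 1)) ∨ (D.NorthOf r c x ∧ V r c) := by
  rw [flowOrientation, arc_black_iff, arc_to_black_iff, or_and_right]
  refine or_congr ?_ (or_congr ?_ ?_)
  · refine and_congr_right ?_
    rintro rfl
    rfl
  · refine and_congr_right ?_
    rintro (⟨rfl, -⟩ | ⟨c', hp', -, -, rfl⟩)
    · rfl
    · simp [flowArc]
  · refine and_congr_right ?_
    rintro ⟨r', hp', h1, h2, rfl⟩
    simp only [flowArc, h1.ne, ne_eq, not_false_eq_true, true_and, false_and, false_or]
    refine (hf.v_eq (Nat.succ_le_of_lt h1) fun r'' h3 h4 => h2 r'' ?_ h4).symm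
    exact Fin.lt_def.2 (by omega)

theorem flowOrientation_white_iff (hf : D.IsFlow H V) {r c} (hp : (r, c) ∈ D.plus)
    (x : Fin n ⊕ D.Vertex) : D.flowOrientation H V x (.inr (.white (r, c) hp)) ↔
      (x = .inr (.black (r, c) hp) ∧ ¬ (H r (c + 1) ∨ V r c)) ∨
      (D.WestOf r c x ∧ H r c) ∨ (D.SouthOf r c x ∧ V (r + 1) c) := by
  rw [flowOrientation, arc_to_white_iff, arc_white_iff, or_and_right]
  refine or_congr ?_ (or_congr ?_ ?_)
  · refine and_congr_right ?_
    rintro rfl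
    rfl
  · refine and_congr_right ?_
    rintro ⟨c', hp', h1, h2, rfl⟩
    simp only [flowArc, ne_eq, not_true_eq_false, true_and, false_and, or_false]
    refine (hf.h_eq (Nat.succ_le_of_lt h1) fun r'' h3 h4 => h2 r'' ?_ h4).symm
    exact Fin.lt_def.2 (by omega)
  · refine and_congr_right ?_
    rintro (⟨rfl, -⟩ | ⟨r', hp', h1, -, rfl⟩)
    · rfl
    · simp [flowArc, h1.ne]

/-- At most one path passes through a `+`. The unique edge out of the black vertex is the reversed
arc by which this path arrives, or the middle edge if there is no path; the edge into the white
vertex is dual. -/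
theorem isPerfectOrientation_flowOrientation (hf : D.IsFlow H V) :
    IsPerfectOrientation D.plabicGraph D.IsBlack (D.flowOrientation H V) := by
  refine ⟨fun x y => ?_, fun x y => ?_, fun v hv => ?_, fun v hv => ?_⟩
  · rw [adj_iff]
    unfold flowOrientation
    tauto
  · unfold flowOrientation
    have := arc_asymm (D := D) (x := x) (y := y)
    tauto
  · cases hv with
    | black p hp =>
      obtain ⟨r, c⟩ := p
      simp only [flowOrientation_black_iff hf]
      have h := (hf.plus r c ((D.hasPlus_iff r c).2 hp)).1
      by_cases hE : H r (c + 1)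
      · have hV : ¬ V r c := fun hV => h ⟨hE, hV⟩
        obtain ⟨x, hx⟩ := D.exists_eastOf r c
        refine ⟨x, Or.inr (Or.inl ⟨hx, hE⟩), ?_⟩
        rintro y (⟨-, h⟩ | ⟨hy, -⟩ | ⟨-, h⟩)
        · exact absurd (Or.inl hE) h
        · exact hy.unique hx
        · exact absurd h hV
      · by_cases hV : V r c
        · obtain ⟨x, hx⟩ := hf.northOf hV
          refine ⟨x, Or.inr (Or.inr ⟨hx, hV⟩), ?_⟩
          rintro y (⟨-, h⟩ | ⟨-, h⟩ | ⟨hy, -⟩)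
          · exact absurd (Or.inr hV) h
          · exact absurd h hE
          · exact hy.unique hx
        · refine ⟨_, Or.inl ⟨rfl, by tauto⟩, ?_⟩
          rintro y (⟨h, -⟩ | ⟨-, h⟩ | ⟨-, h⟩)
          · exact h
          · exact absurd h hE
          · exact absurd h hV
    | leaf c hc =>
      simp only [flowOrientation, arc_blackLeaf_iff, not_arc_to_blackLeaf, false_and, or_false]
      refine ⟨_, ⟨rfl, ?_⟩, fun y hy => hy.1⟩
      simp [flowArc]
  · cases v with
    | black p hp => exact absurd (.black p hp) hv
    | blackLeaf c hc => exact absurd (.leaf c hc) hv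
    | whiteLeaf r hr =>
      simp only [flowOrientation, arc_to_whiteLeaf_iff, not_arc_whiteLeaf, false_and, or_false]
      refine ⟨_, ⟨rfl, ?_⟩, fun y hy => hy.1⟩
      simp [flowArc]
    | white p hp =>
      obtain ⟨r, c⟩ := p
      simp only [flowOrientation_white_iff hf]
      obtain ⟨-, h, h'⟩ := hf.plus r c ((D.hasPlus_iff r c).2 hp)
      rw [h']
      by_cases hH : H r c
      · have hV : ¬ V (r + 1) c := fun hV => h ⟨hH, hV⟩
        obtain ⟨x, hx⟩ := hf.westOf hH
        refine ⟨x, Or.inr (Or.inl ⟨hx, hH⟩), ?_⟩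
        rintro y (⟨-, h⟩ | ⟨hy, -⟩ | ⟨-, h⟩)
        · exact absurd (Or.inl hH) h
        · exact hy.unique hx
        · exact absurd h hV
      · by_cases hV : V (r + 1) c
        · obtain ⟨x, hx⟩ := D.exists_southOf r c
          refine ⟨x, Or.inr (Or.inr ⟨hx, hV⟩), ?_⟩
          rintro y (⟨-, h⟩ | ⟨-, h⟩ | ⟨hy, -⟩)
          · exact absurd (Or.inr hV) h
          · exact absurd h hH
          · exact hy.unique hx
        · refine ⟨_, Or.inl ⟨rfl, by tauto⟩, ?_⟩
          rintro y (⟨h, -⟩ | ⟨-, h⟩ | ⟨-, h⟩)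
          · exact h
          · exact absurd h hH
          · exact absurd h hV

theorem exists_rowEnd (D : LeDiagram k n) (r : Fin k) : ∃ x, D.RowEnd r x := by
  by_cases h : ∀ c, (r, c) ∉ D.plus
  · exact ⟨_, Or.inr ⟨h, rfl⟩⟩
  · push Not at h
    obtain ⟨c', hc'⟩ := h
    classical
    obtain ⟨c, hc, hmax⟩ := (Finset.univ.filter fun c' => (r, c') ∈ D.plus).exists_max_image id
      ⟨c', by simp [hc']⟩
    simp only [Finset.mem_filter, Finset.mem_univ, true_and, id] at hc hmax
    exact ⟨_, Or.inl ⟨c, hc, fun c'' h1 h2 => absurd (hmax _ h2) (not_le.2 h1), rfl⟩⟩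

theorem exists_colEnd (D : LeDiagram k n) (c : Fin (n - k)) : ∃ x, D.ColEnd c x := by
  by_cases h : ∀ r, (r, c) ∉ D.plus
  · exact ⟨_, Or.inr ⟨h, rfl⟩⟩
  · push Not at h
    obtain ⟨r', hr'⟩ := h
    classical
    obtain ⟨r, hr, hmax⟩ := (Finset.univ.filter fun r' => (r', c) ∈ D.plus).exists_max_image id
      ⟨r', by simp [hr']⟩
    simp only [Finset.mem_filter, Finset.mem_univ, true_and, id] at hr hmax
    exact ⟨_, Or.inl ⟨r, hr, fun c'' h1 h2 => absurd (hmax _ h2) (not_le.2 h1), rfl⟩⟩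

theorem RowEnd.unique {r : Fin k} {x y : Fin n ⊕ D.Vertex} (hx : D.RowEnd r x)
    (hy : D.RowEnd r y) : x = y := by
  rcases hx with ⟨c, hp, h, rfl⟩ | ⟨hr, rfl⟩ <;> rcases hy with ⟨c', hp', h', rfl⟩ | ⟨hr', rfl⟩
  · rcases lt_trichotomy c c' with h1 | rfl | h1
    · exact absurd hp' (h _ h1)
    · rfl
    · exact absurd hp (h' _ h1)
  · exact absurd hp (hr' _)
  · exact absurd hp' (hr _)
  · rfl

theorem ColEnd.unique {c : Fin (n - k)} {x y : Fin n ⊕ D.Vertex} (hx : D.ColEnd c x)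
    (hy : D.ColEnd c y) : x = y := by
  rcases hx with ⟨c, hp, h, rfl⟩ | ⟨hr, rfl⟩ <;> rcases hy with ⟨c', hp', h', rfl⟩ | ⟨hr', rfl⟩
  · rcases lt_trichotomy c c' with h1 | rfl | h1
    · exact absurd hp' (h _ h1)
    · rfl
    · exact absurd hp (h' _ h1)
  · exact absurd hp (hr' _)
  · exact absurd hp' (hr _)
  · rfl

theorem flowArc_rowEnd (hf : D.IsFlow H V) {r : Fin k} {x : Fin n ⊕ D.Vertex}
    (hx : D.RowEnd r x) : D.flowArc H V (.inl (D.rowLabel r)) x ↔ H r (n - k) := by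
  rcases hx with ⟨c, hp, h, rfl⟩ | ⟨hr, rfl⟩
  · refine (hf.h_eq (Nat.succ_le_of_lt c.2) fun c' h1 _ => h c' ?_).symm
    exact Fin.lt_def.2 (by omega)
  · have := hf.h_eq (Nat.zero_le (n - k)) fun c _ _ => hr c
    simp [this, hf.left, flowArc]

theorem flowArc_colEnd (hf : D.IsFlow H V) {c : Fin (n - k)} {x : Fin n ⊕ D.Vertex}
    (hx : D.ColEnd c x) : D.flowArc H V x (.inl (D.colLabel c)) ↔ V k c := by
  rcases hx with ⟨r, hp, h, rfl⟩ | ⟨hr, rfl⟩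
  · refine (hf.v_eq (Nat.succ_le_of_lt r.2) fun r' h1 _ => h r' ?_).symm
    exact Fin.lt_def.2 (by omega)
  · have := hf.v_eq (Nat.zero_le k) fun c _ _ => hr c
    simp [this, hf.top, flowArc]

theorem exists_flowOrientation_iff (hf : D.IsFlow H V) (i : Fin n) :
    (∃ x, D.flowOrientation H V (.inl i) x) ↔ i ∈ D.flowSources H V := by
  rcases D.exists_label i with ⟨r, rfl⟩ | ⟨c, rfl⟩
  · rw [rowLabel_mem_flowSources]
    simp only [flowOrientation, arc_rowLabel_iff, not_arc_to_rowLabel, false_and, or_false]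
    constructor
    · rintro ⟨x, hx, h⟩
      rwa [flowArc_rowEnd hf hx] at h
    · intro h
      obtain ⟨x, hx⟩ := D.exists_rowEnd r
      exact ⟨x, hx, by rwa [flowArc_rowEnd hf hx]⟩
  · rw [colLabel_mem_flowSources]
    simp only [flowOrientation, arc_to_colLabel_iff, not_arc_colLabel, false_and, false_or]
    constructor
    · rintro ⟨x, hx, h⟩
      rwa [flowArc_colEnd hf hx] at h
    · intro h
      obtain ⟨x, hx⟩ := D.exists_colEnd c
      exact ⟨x, hx, by rwa [flowArc_colEnd hf hx]⟩

end Flow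

/-! ### From perfect orientations to flows -/

section Orientation

variable (D : LeDiagram k n) (o : Fin n ⊕ D.Vertex → Fin n ⊕ D.Vertex → Prop)

/-- The edge going east from the box `(r, c)` is directed to the right. -/
def EastReversed (r c : ℕ) : Prop :=
  ∃ (r' : Fin k) (c' : Fin (n - k)) (hp : (r', c') ∈ D.plus) (x : Fin n ⊕ D.Vertex),
    (r' : ℕ) = r ∧ (c' : ℕ) = c ∧ D.EastOf r' c' x ∧ o (.inr (.black (r', c') hp)) x

/-- The edge going south from the box `(r, c)` is directed upwards. -/
def SouthReversed (r c : ℕ) : Prop :=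
  ∃ (r' : Fin k) (c' : Fin (n - k)) (hp : (r', c') ∈ D.plus) (x : Fin n ⊕ D.Vertex),
    (r' : ℕ) = r ∧ (c' : ℕ) = c ∧ D.SouthOf r' c' x ∧ o x (.inr (.white (r', c') hp))

theorem eastReversed_iff {r : Fin k} {c : Fin (n - k)} (hp : (r, c) ∈ D.plus) :
    D.EastReversed o r c ↔ ∃ x, D.EastOf r c x ∧ o (.inr (.black (r, c) hp)) x := by
  constructor
  · rintro ⟨r', c', hp', x, h1, h2, h3, h4⟩
    obtain rfl := Fin.ext h1
    obtain rfl := Fin.ext h2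
    exact ⟨x, h3, h4⟩
  · rintro ⟨x, h3, h4⟩
    exact ⟨r, c, hp, x, rfl, rfl, h3, h4⟩

theorem southReversed_iff {r : Fin k} {c : Fin (n - k)} (hp : (r, c) ∈ D.plus) :
    D.SouthReversed o r c ↔ ∃ x, D.SouthOf r c x ∧ o x (.inr (.white (r, c) hp)) := by
  constructor
  · rintro ⟨r', c', hp', x, h1, h2, h3, h4⟩
    obtain rfl := Fin.ext h1
    obtain rfl := Fin.ext h2
    exact ⟨x, h3, h4⟩
  · rintro ⟨x, h3, h4⟩
    exact ⟨r, c, hp, x, rfl, rfl, h3, h4⟩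

/-- The edge west of a `+` is the edge east of the previous `+` of its row, whose status `carry`
transports across the boxes without `+`. -/
theorem carry_eastReversed_iff {r : Fin k} {c : Fin (n - k)} (hp : (r, c) ∈ D.plus) :
    carry (D.HasPlus r) (D.EastReversed o r) c ↔
      ∃ x, D.WestOf r c x ∧ o x (.inr (.white (r, c) hp)) := by
  rw [carry_iff]
  constructor
  · rintro ⟨c', h1, -, ⟨r', c', hp', x, h2, rfl, h3, h4⟩, h5⟩
    obtain rfl := Fin.ext h2
    have h6 : ∀ c'' : Fin (n - k), c' < c'' → c'' < c → (r', c'') ∉ D.plus :=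
      fun c'' h7 h8 => mt (D.hasPlus_iff r' c'').2 (h5 c'' h7 h8)
    obtain rfl := h3.unique (Or.inr ⟨c, hp, h1, h6, rfl⟩)
    exact ⟨_, ⟨c', hp', h1, h6, rfl⟩, h4⟩
  · rintro ⟨_, ⟨c', hp', h1, h2, rfl⟩, h3⟩
    refine ⟨c', h1, (D.hasPlus_iff _ _).2 hp', (D.eastReversed_iff o hp').2
      ⟨_, Or.inr ⟨c, hp, h1, h2, rfl⟩, h3⟩, fun c'' h4 h5 => ?_⟩
    exact mt (D.hasPlus_iff r ⟨c'', h5.trans c.2⟩).1 (h2 ⟨c'', h5.trans c.2⟩ h4 h5)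

theorem carry_southReversed_iff {r : Fin k} {c : Fin (n - k)} (hp : (r, c) ∈ D.plus) :
    carry (fun r => D.HasPlus r c) (fun r => D.SouthReversed o r c) r ↔
      ∃ x, D.NorthOf r c x ∧ o (.inr (.black (r, c) hp)) x := by
  rw [carry_iff]
  constructor
  · rintro ⟨r', h1, -, ⟨r', c', hp', x, rfl, h2, h3, h4⟩, h5⟩
    obtain rfl := Fin.ext h2
    have h6 : ∀ r'' : Fin k, r' < r'' → r'' < r → (r'', c') ∉ D.plus :=
      fun c'' h7 h8 => mt (D.hasPlus_iff c'' c').2 (h5 c'' h7 h8)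
    obtain rfl := h3.unique (Or.inr ⟨r, hp, h1, h6, rfl⟩)
    exact ⟨_, ⟨r', hp', h1, h6, rfl⟩, h4⟩
  · rintro ⟨_, ⟨r', hp', h1, h2, rfl⟩, h3⟩
    refine ⟨r', h1, (D.hasPlus_iff _ _).2 hp', (D.southReversed_iff o hp').2
      ⟨_, Or.inr ⟨r, hp, h1, h2, rfl⟩, h3⟩, fun c'' h4 h5 => ?_⟩
    exact mt (D.hasPlus_iff ⟨c'', h5.trans r.2⟩ c).1 (h2 ⟨c'', h5.trans r.2⟩ h4 h5)

variable {o}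

/-- The edges which are reversed in a perfect orientation form a flow. -/
theorem isFlow_of_isPerfectOrientation (ho : IsPerfectOrientation D.plabicGraph D.IsBlack o) :
    D.IsFlow (fun r => carry (D.HasPlus r) (D.EastReversed o r))
      (fun r c => carry (fun r => D.HasPlus r c) (fun r => D.SouthReversed o r c) r) where
  left r h := h
  top c h := h
  pass_h r c h := by simp [carry, h]
  pass_v r c h := by simp [carry, h]
  plus r c h := by
    obtain ⟨⟨r, c⟩, hp, rfl, rfl⟩ := h
    have hH : carry (D.HasPlus r) (D.EastReversed o r) (c + 1) ↔ D.EastReversed o r c := by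
      simp [carry, (D.hasPlus_iff r c).2 hp]
    have hV : carry (fun r => D.HasPlus r c) (fun r => D.SouthReversed o r c) (r + 1) ↔
        D.SouthReversed o r c := by
      simp [carry, (D.hasPlus_iff r c).2 hp]
    simp only [hH, hV, D.eastReversed_iff o hp, D.southReversed_iff o hp,
      D.carry_eastReversed_iff o hp, D.carry_southReversed_iff o hp]
    obtain ⟨hadj, -, hb, hw⟩ := ho
    obtain ⟨x, hx, hxu⟩ := hb _ (.black _ hp)
    obtain ⟨y, hy, hyu⟩ := hw (.white _ hp) (by intro h; cases h)
    have hxc : x = .inr (.white (r, c) hp) ∨ D.EastOf r c x ∨ D.NorthOf r c x := by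
      have := (hadj _ _).2 (Or.inl hx)
      rwa [adj_iff, arc_black_iff, arc_to_black_iff] at this
    have hyc : y = .inr (.black (r, c) hp) ∨ D.WestOf r c y ∨ D.SouthOf r c y := by
      have := (hadj _ _).2 (Or.inl hy)
      rwa [adj_iff, arc_to_white_iff, arc_white_iff] at this
    have hE : (∃ z, D.EastOf r c z ∧ o (.inr (.black (r, c) hp)) z) ↔ D.EastOf r c x := by
      constructor
      · rintro ⟨z, hz, hz'⟩
        rwa [← hxu z hz']
      · exact fun h => ⟨x, h, hx⟩
    have hN : (∃ z, D.NorthOf r c z ∧ o (.inr (.black (r, c) hp)) z) ↔ D.NorthOf r c x := by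
      constructor
      · rintro ⟨z, hz, hz'⟩
        rwa [← hxu z hz']
      · exact fun h => ⟨x, h, hx⟩
    have hW : (∃ z, D.WestOf r c z ∧ o z (.inr (.white (r, c) hp))) ↔ D.WestOf r c y := by
      constructor
      · rintro ⟨z, hz, hz'⟩
        rwa [← hyu z hz']
      · exact fun h => ⟨y, h, hy⟩
    have hS : (∃ z, D.SouthOf r c z ∧ o z (.inr (.white (r, c) hp))) ↔ D.SouthOf r c y := by
      constructor
      · rintro ⟨z, hz, hz'⟩
        rwa [← hyu z hz']
      · exact fun h => ⟨y, h, hy⟩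
    rw [hE, hN, hW, hS]
    refine ⟨fun h => h.1.not_northOf h.2, fun h => h.2.not_westOf h.1, ?_⟩
    have h1 : x = .inr (.white (r, c) hp) ↔ ¬ (D.EastOf r c x ∨ D.NorthOf r c x) := by
      refine ⟨?_, fun h => hxc.resolve_right h⟩
      rintro rfl
      rintro ((⟨h, -⟩ | ⟨c', hp', h, -, h'⟩) | ⟨r', hp', h, -, h'⟩)
      · simp at h
      · simp only [Sum.inr.injEq, Vertex.white.injEq, Prod.mk.injEq] at h'
        exact h.ne h'.2
      · simp only [Sum.inr.injEq, Vertex.white.injEq, Prod.mk.injEq] at h'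
        exact h.ne' h'.1
    have h2 : y = .inr (.black (r, c) hp) ↔ ¬ (D.WestOf r c y ∨ D.SouthOf r c y) := by
      refine ⟨?_, fun h => hyc.resolve_right h⟩
      rintro rfl
      rintro (⟨r', hp', h, -, h'⟩ | (⟨h, -⟩ | ⟨c', hp', h, -, h'⟩))
      · simp only [Sum.inr.injEq, Vertex.black.injEq, Prod.mk.injEq] at h'
        exact h.ne' h'.2
      · simp at h
      · simp only [Sum.inr.injEq, Vertex.black.injEq, Prod.mk.injEq] at h'
        exact h.ne h'.1
    -- The middle edge is the distinguished edge either at both of its ends or at neither; negating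
    -- this gives the conservation law.
    have h3 : x = .inr (.white (r, c) hp) ↔ y = .inr (.black (r, c) hp) := by
      constructor
      · rintro rfl
        exact (hyu _ hx).symm
      · rintro rfl
        exact (hxu _ hy).symm
    exact not_iff_not.1 (h1.symm.trans (h3.trans h2))

theorem exists_source_iff (ho : IsPerfectOrientation D.plabicGraph D.IsBlack o) (i : Fin n) :
    (∃ x, o (.inl i) x) ↔
      i ∈ D.flowSources (fun r => carry (D.HasPlus r) (D.EastReversed o r))
        (fun r c => carry (fun r => D.HasPlus r c) (fun r => D.SouthReversed o r c) r) := by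
  have hf := D.isFlow_of_isPerfectOrientation ho
  obtain ⟨hadj, hasym, hb, hw⟩ := ho
  rcases D.exists_label i with ⟨r, rfl⟩ | ⟨c, rfl⟩
  · rw [rowLabel_mem_flowSources]
    obtain ⟨x, hx⟩ := D.exists_rowEnd r
    have hadj' : ∀ y, (o (.inl (D.rowLabel r)) y ∨ o y (.inl (D.rowLabel r))) ↔ y = x := by
      intro y
      rw [← hadj, adj_iff, arc_rowLabel_iff, or_iff_left not_arc_to_rowLabel]
      exact ⟨fun h => h.unique hx, by rintro rfl; exact hx⟩
    have h1 : (∃ y, o (.inl (D.rowLabel r)) y) ↔ ¬ o x (.inl (D.rowLabel r)) := by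
      constructor
      · rintro ⟨y, hy⟩
        obtain rfl := (hadj' y).1 (Or.inl hy)
        exact hasym _ _ hy
      · exact fun h => ⟨x, ((hadj' x).2 rfl).resolve_right h⟩
    rw [h1, not_iff_not]
    rcases hx with ⟨c, hp, h, rfl⟩ | ⟨hr, rfl⟩
    · rw [hf.h_eq (Nat.succ_le_of_lt c.2) fun c' h1 _ => h c' (Fin.lt_def.2 (by omega))]
      have hH : carry (D.HasPlus r) (D.EastReversed o r) (c + 1) ↔ D.EastReversed o r c := by
        simp [carry, (D.hasPlus_iff r c).2 hp]
      rw [Nat.succ_eq_add_one, hH, D.eastReversed_iff o hp]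
      constructor
      · exact fun h' => ⟨_, Or.inl ⟨rfl, h⟩, h'⟩
      · rintro ⟨y, hy, hy'⟩
        rwa [hy.unique (Or.inl ⟨rfl, h⟩)] at hy'
    · rw [hf.h_eq (Nat.zero_le (n - k)) fun c _ _ => hr c]
      -- A white lollipop needs an incoming edge and has only the edge to the border, so its label
      -- is always a source.
      refine iff_of_false (fun h' => ?_) (hf.left r)
      obtain ⟨y, hy, -⟩ := hw (.whiteLeaf r hr) (by intro h; cases h)
      have := (hadj _ _).2 (Or.inl hy)
      rw [adj_iff, arc_to_whiteLeaf_iff, or_iff_left (not_arc_whiteLeaf hr)] at this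
      subst this
      exact hasym _ _ h' hy
  · rw [colLabel_mem_flowSources]
    obtain ⟨x, hx⟩ := D.exists_colEnd c
    have hadj' : ∀ y, (o (.inl (D.colLabel c)) y ∨ o y (.inl (D.colLabel c))) ↔ y = x := by
      intro y
      rw [← hadj, adj_iff, arc_to_colLabel_iff, or_iff_right not_arc_colLabel]
      exact ⟨fun h => h.unique hx, by rintro rfl; exact hx⟩
    have h1 : (∃ y, o (.inl (D.colLabel c)) y) ↔ o (.inl (D.colLabel c)) x := by
      constructor
      · rintro ⟨y, hy⟩
        rwa [(hadj' y).1 (Or.inl hy)] at hy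
      · exact fun h => ⟨x, h⟩
    rw [h1]
    rcases hx with ⟨r, hp, h, rfl⟩ | ⟨hc, rfl⟩
    · rw [hf.v_eq (Nat.succ_le_of_lt r.2) fun c' h1 _ => h c' (Fin.lt_def.2 (by omega))]
      have hV : carry (fun r => D.HasPlus r c) (fun r => D.SouthReversed o r c) (r + 1) ↔
          D.SouthReversed o r c := by
        simp [carry, (D.hasPlus_iff r c).2 hp]
      rw [Nat.succ_eq_add_one, hV, D.southReversed_iff o hp]
      constructor
      · exact fun h' => ⟨_, Or.inl ⟨rfl, h⟩, h'⟩
      · rintro ⟨y, hy, hy'⟩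
        rwa [hy.unique (Or.inl ⟨rfl, h⟩)] at hy'
    · rw [hf.v_eq (Nat.zero_le k) fun c _ _ => hc c]
      refine iff_of_false (fun h' => ?_) (hf.top c)
      obtain ⟨y, hy, -⟩ := hb _ (.leaf c hc)
      have := (hadj _ _).2 (Or.inl hy)
      rw [adj_iff, arc_blackLeaf_iff, or_iff_left (not_arc_to_blackLeaf hc)] at this
      subst this
      exact hasym _ _ h' hy

end Orientation

/-- The bases of the positroid of `D` are given by the flows in its network. -/
theorem mem_positroid_iff (D : LeDiagram k n) (I : Finset (Fin n)) :
    I ∈ D.positroid ↔ ∃ H V, D.IsFlow H V ∧ ∀ i, i ∈ I ↔ i ∈ D.flowSources H V := by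
  constructor
  · rintro ⟨o, ho, hI⟩
    exact ⟨_, _, D.isFlow_of_isPerfectOrientation ho, fun i => (hI i).trans (D.exists_source_iff ho i)⟩
  · rintro ⟨H, V, hf, hI⟩
    exact ⟨_, isPerfectOrientation_flowOrientation hf,
      fun i => (hI i).trans (exists_flowOrientation_iff hf i).symm⟩

/-! ### Labels in every basis and labels missing from some basis -/

theorem HasPlus.mem_shape {D : LeDiagram k n} {a b : ℕ} (h : D.HasPlus a b) : (a, b) ∈ D.shape := by
  obtain ⟨p, hp, rfl, rfl⟩ := h
  exact D.plus_sub p hp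

theorem mem_positroid_of_isFlow {D : LeDiagram k n} {H V : ℕ → ℕ → Prop} (hf : D.IsFlow H V) :
    ∃ I ∈ D.positroid, ∀ i, i ∈ I ↔ i ∈ D.flowSources H V := by
  classical
  refine ⟨Finset.univ.filter (· ∈ D.flowSources H V), ?_, by simp⟩
  rw [mem_positroid_iff]
  exact ⟨H, V, hf, by simp⟩

theorem isFlow_false (D : LeDiagram k n) : D.IsFlow (fun _ _ => False) (fun _ _ => False) := by
  constructor <;> simp

theorem exists_mem_positroid_colLabel_notMem (D : LeDiagram k n) (c : Fin (n - k)) :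
    ∃ I ∈ D.positroid, D.colLabel c ∉ I := by
  obtain ⟨I, hI, h⟩ := mem_positroid_of_isFlow D.isFlow_false
  exact ⟨I, hI, by rw [h, colLabel_mem_flowSources]; simp⟩

/-- The path which enters at row `r`, turns at the first `+` of the row, and goes straight down. -/
theorem isFlow_singlePath (D : LeDiagram k n) {r c : ℕ} (hp : D.HasPlus r c)
    (hlast : ∀ c', c < c' → ¬ D.HasPlus r c') :
    D.IsFlow (fun a b => a = r ∧ c < b) (fun a b => b = c ∧ r < a) where
  left := by simp
  top := by simp
  pass_h a b h := by
    have : ¬ (a = r ∧ b = c) := by rintro ⟨rfl, rfl⟩; exact h hp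
    omega
  pass_v a b h := by
    have : ¬ (a = r ∧ b = c) := by rintro ⟨rfl, rfl⟩; exact h hp
    omega
  plus a b h := by
    have : a = r → b ≤ c := by
      rintro rfl
      by_contra hb
      exact hlast b (by omega) h
    omega

theorem exists_mem_positroid_rowLabel_notMem (D : LeDiagram k n) {r : Fin k} {c : Fin (n - k)}
    (hp : (r, c) ∈ D.plus) : ∃ I ∈ D.positroid, D.rowLabel r ∉ I := by
  classical
  obtain ⟨c, hc, hmax⟩ := (Finset.univ.filter fun c' => (r, c') ∈ D.plus).exists_max_image id
    ⟨c, by simp [hp]⟩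
  simp only [Finset.mem_filter, Finset.mem_univ, true_and, id] at hc hmax
  have hf := D.isFlow_singlePath ((D.hasPlus_iff r c).2 hc) (by
    rintro c' h1 ⟨⟨r', c'⟩, h2, h3, rfl⟩
    obtain rfl := Fin.ext h3
    exact absurd (hmax _ h2) (not_le.2 h1))
  obtain ⟨I, hI, h⟩ := mem_positroid_of_isFlow hf
  exact ⟨I, hI, by rw [h, rowLabel_mem_flowSources]; simp⟩

theorem rowLabel_mem_of_mem_positroid (D : LeDiagram k n) {r : Fin k} (hr : ∀ c, (r, c) ∉ D.plus)
    {I : Finset (Fin n)} (hI : I ∈ D.positroid) : D.rowLabel r ∈ I := by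
  obtain ⟨H, V, hf, h⟩ := (D.mem_positroid_iff I).1 hI
  rw [h, rowLabel_mem_flowSources, hf.h_eq (Nat.zero_le (n - k)) fun c _ _ => hr c]
  exact hf.left r

theorem colLabel_notMem_of_mem_positroid (D : LeDiagram k n) {c : Fin (n - k)}
    (hc : ∀ r, (r, c) ∉ D.plus) {I : Finset (Fin n)} (hI : I ∈ D.positroid) :
    D.colLabel c ∉ I := by
  obtain ⟨H, V, hf, h⟩ := (D.mem_positroid_iff I).1 hI
  rw [h, colLabel_mem_flowSources, hf.v_eq (Nat.zero_le k) fun r _ _ => hc r]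
  exact hf.top c

/-! ### Removing a corner box -/

/-- Change a flow to the right of and below the box `(r, c)`. -/
theorem IsFlow.modify {D D' : LeDiagram k n} {H V : ℕ → ℕ → Prop} (hf : D.IsFlow H V) {r c : ℕ}
    {e s : Prop} (hD : ∀ a b, ¬ (a = r ∧ b = c) → (D'.HasPlus a b ↔ D.HasPlus a b))
    (hr : ∀ b, D'.HasPlus r b → b ≤ c) (hc : ∀ a, D'.HasPlus a c → a ≤ r)
    (hpass : ¬ D'.HasPlus r c → (e ↔ H r c) ∧ (s ↔ V r c))
    (hplus : D'.HasPlus r c → ¬ (e ∧ V r c) ∧ ¬ (H r c ∧ s) ∧ ((e ∨ V r c) ↔ (H r c ∨ s))) :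
    D'.IsFlow (fun a b => if a = r ∧ c < b then e else H a b)
      (fun a b => if b = c ∧ r < a then s else V a b) where
  left a := by simpa using hf.left a
  top b := by simpa using hf.top b
  pass_h a b h := by
    by_cases hab : a = r ∧ b = c
    · obtain ⟨rfl, rfl⟩ := hab
      simpa using (hpass h).1
    · have h1 := hf.pass_h a b (by rwa [← hD a b hab])
      by_cases h2 : a = r ∧ c < b
      · rw [if_pos h2, if_pos (by omega)]
      · rw [if_neg h2, if_neg (by omega), h1]
  pass_v a b h := by
    by_cases hab : a = r ∧ b = c
    · obtain ⟨rfl, rfl⟩ := hab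
      simpa using (hpass h).2
    · have h1 := hf.pass_v a b (by rwa [← hD a b hab])
      by_cases h2 : b = c ∧ r < a
      · rw [if_pos h2, if_pos (by omega)]
      · rw [if_neg h2, if_neg (by omega), h1]
  plus a b h := by
    by_cases hab : a = r ∧ b = c
    · obtain ⟨rfl, rfl⟩ := hab
      simpa using hplus h
    · have h1 := hf.plus a b (by rwa [← hD a b hab])
      have h2 : a = r → b ≤ c := by rintro rfl; exact hr b h
      have h3 : b = c → a ≤ r := by rintro rfl; exact hc a h
      rw [if_neg (by omega), if_neg (by omega), if_neg (by omega), if_neg (by omega)]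
      exact h1

/-- Remove a corner box from the diagram. -/
def eraseCorner (D : LeDiagram k n) (r : Fin k) (c : Fin (n - k))
    (hr : ((r : ℕ) + 1, (c : ℕ)) ∉ D.shape) (hc : ((r : ℕ), (c : ℕ) + 1) ∉ D.shape) :
    LeDiagram k n where
  k_le := D.k_le
  shape :=
    { cells := D.shape.cells.erase (r, c)
      isLowerSet := by
        rw [Finset.coe_erase]
        refine D.shape.isLowerSet.erase ?_
        rintro ⟨a, b⟩ hab ⟨h1, h2⟩
        simp only at h1 h2
        by_contra hne
        rw [Prod.mk.injEq] at hne
        rcases (by omega : (r : ℕ) + 1 ≤ a ∨ (c : ℕ) + 1 ≤ b) with h | h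
        · exact hr (D.shape.up_left_mem h h2 hab)
        · exact hc (D.shape.up_left_mem h1 h hab) }
  shape_sub p hp := D.shape_sub p (Finset.mem_of_mem_erase hp)
  plus := D.plus.erase (r, c)
  plus_sub p hp := by
    rw [Finset.mem_erase] at hp
    refine Finset.mem_erase.2 ⟨fun h => hp.1 ?_, D.plus_sub p hp.2⟩
    rw [Prod.mk.injEq] at h
    exact Prod.ext (Fin.ext h.1) (Fin.ext h.2)
  le_property a a' b b' hab h1 h2 h3 h4 := by
    have hab' := Finset.mem_erase.1 hab
    refine Finset.mem_erase.2 ⟨fun h => hab'.1 ?_, D.le_property a a' b b' hab'.2 h1 h2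
      (Finset.mem_of_mem_erase h3) (Finset.mem_of_mem_erase h4)⟩
    rw [Prod.mk.injEq] at h
    rw [h.1, h.2]

section EraseCorner

variable {D : LeDiagram k n} {r : Fin k} {c : Fin (n - k)}
  {hr : ((r : ℕ) + 1, (c : ℕ)) ∉ D.shape} {hc : ((r : ℕ), (c : ℕ) + 1) ∉ D.shape}

theorem hasPlus_eraseCorner_iff (a b : ℕ) :
    (D.eraseCorner r c hr hc).HasPlus a b ↔ D.HasPlus a b ∧ ¬ (a = r ∧ b = c) := by
  constructor
  · rintro ⟨⟨p, q⟩, hp, rfl, rfl⟩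
    have hp' := Finset.mem_erase.1 hp
    refine ⟨⟨_, hp'.2, rfl, rfl⟩, fun h => hp'.1 ?_⟩
    exact Prod.ext (Fin.ext h.1) (Fin.ext h.2)
  · rintro ⟨⟨⟨p, q⟩, hp, rfl, rfl⟩, h⟩
    refine ⟨_, Finset.mem_erase.2 ⟨fun h' => h ?_, hp⟩, rfl, rfl⟩
    rw [Prod.mk.injEq] at h'
    rw [h'.1, h'.2]
    exact ⟨rfl, rfl⟩

theorem mem_shape_eraseCorner (a b : ℕ) :
    (a, b) ∈ (D.eraseCorner r c hr hc).shape ↔ (a, b) ∈ D.shape ∧ ¬ (a = r ∧ b = c) := by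
  have : (a, b) ∈ (D.eraseCorner r c hr hc).shape ↔ (a, b) ∈ D.shape.cells.erase (↑r, ↑c) := Iff.rfl
  rw [this, Finset.mem_erase, Ne, Prod.mk.injEq, YoungDiagram.mem_cells, and_comm]

theorem rowLen_of_corner (hmem : ((r : ℕ), (c : ℕ)) ∈ D.shape)
    (hc : ((r : ℕ), (c : ℕ) + 1) ∉ D.shape) : D.shape.rowLen r = c + 1 := by
  rw [YoungDiagram.mem_iff_lt_rowLen] at hmem hc
  omega

theorem colLen_of_corner (hmem : ((r : ℕ), (c : ℕ)) ∈ D.shape)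
    (hr : ((r : ℕ) + 1, (c : ℕ)) ∉ D.shape) : D.shape.colLen c = r + 1 := by
  rw [YoungDiagram.mem_iff_lt_colLen] at hmem hr
  omega

theorem colLabel_of_corner (hmem : ((r : ℕ), (c : ℕ)) ∈ D.shape)
    (hr : ((r : ℕ) + 1, (c : ℕ)) ∉ D.shape) (hc : ((r : ℕ), (c : ℕ) + 1) ∉ D.shape) :
    (D.colLabel c : ℕ) = D.rowLabel r + 1 := by
  have := c.2
  simp only [colLabel, rowLabel, rowLen_of_corner hmem hc, colLen_of_corner hmem hr]
  omega

theorem rowLen_eraseCorner (hmem : ((r : ℕ), (c : ℕ)) ∈ D.shape) (a : ℕ) :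
    (D.eraseCorner r c hr hc).shape.rowLen a = if a = r then (c : ℕ) else D.shape.rowLen a := by
  have h : ∀ b, b < (D.eraseCorner r c hr hc).shape.rowLen a ↔
      b < D.shape.rowLen a ∧ ¬ (a = r ∧ b = c) := by
    intro b
    rw [← YoungDiagram.mem_iff_lt_rowLen, ← YoungDiagram.mem_iff_lt_rowLen, mem_shape_eraseCorner]
  have h0 := rowLen_of_corner hmem hc
  have h1 := h ((D.eraseCorner r c hr hc).shape.rowLen a)
  split_ifs with ha
  · subst ha
    have h2 := h c
    have h3 := h (c - 1)
    omega
  · have h2 := h (D.shape.rowLen a)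
    omega

theorem colLen_eraseCorner (hmem : ((r : ℕ), (c : ℕ)) ∈ D.shape) (b : ℕ) :
    (D.eraseCorner r c hr hc).shape.colLen b = if b = c then (r : ℕ) else D.shape.colLen b := by
  have h : ∀ a, a < (D.eraseCorner r c hr hc).shape.colLen b ↔
      a < D.shape.colLen b ∧ ¬ (a = r ∧ b = c) := by
    intro b
    rw [← YoungDiagram.mem_iff_lt_colLen, ← YoungDiagram.mem_iff_lt_colLen, mem_shape_eraseCorner]
  have h0 := colLen_of_corner hmem hr
  have h1 := h ((D.eraseCorner r c hr hc).shape.colLen b)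
  split_ifs with ha
  · subst ha
    have h2 := h r
    have h3 := h (r - 1)
    omega
  · have h2 := h (D.shape.colLen b)
    omega

theorem rowLabel_eraseCorner (hmem : ((r : ℕ), (c : ℕ)) ∈ D.shape) (a : Fin k) :
    (D.eraseCorner r c hr hc).rowLabel a =
      Equiv.swap (D.rowLabel r) (D.colLabel c) (D.rowLabel a) := by
  by_cases ha : a = r
  · subst ha
    rw [Equiv.swap_apply_left]
    apply Fin.ext
    have := c.2
    simp only [rowLabel, rowLen_eraseCorner hmem, colLabel, colLen_of_corner hmem hr, if_true]
    omega
  · rw [Equiv.swap_apply_of_ne_of_ne (D.rowLabel_strictMono.injective.ne ha)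
      (D.rowLabel_ne_colLabel a c)]
    simp only [rowLabel, rowLen_eraseCorner hmem, if_neg (mt Fin.ext ha)]

theorem colLabel_eraseCorner (hmem : ((r : ℕ), (c : ℕ)) ∈ D.shape) (b : Fin (n - k)) :
    (D.eraseCorner r c hr hc).colLabel b =
      Equiv.swap (D.rowLabel r) (D.colLabel c) (D.colLabel b) := by
  by_cases hb : b = c
  · subst hb
    rw [Equiv.swap_apply_right]
    apply Fin.ext
    have := b.2
    simp only [rowLabel, colLen_eraseCorner hmem, colLabel, rowLen_of_corner hmem hc, if_true]
    omega
  · rw [Equiv.swap_apply_of_ne_of_ne (D.rowLabel_ne_colLabel r b).symm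
      (D.colLabel_strictAnti.injective.ne hb)]
    simp only [colLabel, colLen_eraseCorner hmem, if_neg (mt Fin.ext hb)]

/-- The two border steps around the removed corner trade places, so one and the same flow has the
same sources up to exchanging two adjacent labels. -/
theorem mem_flowSources_eraseCorner (hmem : ((r : ℕ), (c : ℕ)) ∈ D.shape) {H V : ℕ → ℕ → Prop}
    (i : Fin n) : i ∈ (D.eraseCorner r c hr hc).flowSources H V ↔
      Equiv.swap (D.rowLabel r) (D.colLabel c) i ∈ D.flowSources H V := by
  simp only [flowSources, Set.mem_ofPred_eq, rowLabel_eraseCorner hmem, colLabel_eraseCorner hmem,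
    Equiv.swap_apply_eq_iff]

theorem rowLabel_mem_flowSources_eraseCorner (hmem : ((r : ℕ), (c : ℕ)) ∈ D.shape)
    {H V : ℕ → ℕ → Prop} : D.rowLabel r ∈ (D.eraseCorner r c hr hc).flowSources H V ↔ V k c := by
  rw [mem_flowSources_eraseCorner hmem, Equiv.swap_apply_left, colLabel_mem_flowSources]

theorem colLabel_mem_flowSources_eraseCorner (hmem : ((r : ℕ), (c : ℕ)) ∈ D.shape)
    {H V : ℕ → ℕ → Prop} :
    D.colLabel c ∈ (D.eraseCorner r c hr hc).flowSources H V ↔ ¬ H r (n - k) := by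
  rw [mem_flowSources_eraseCorner hmem, Equiv.swap_apply_right, rowLabel_mem_flowSources]

theorem mem_flowSources_congr {H V H' V' : ℕ → ℕ → Prop}
    (hH : ∀ a, a ≠ (r : ℕ) → (H a (n - k) ↔ H' a (n - k)))
    (hV : ∀ b, b ≠ (c : ℕ) → (V k b ↔ V' k b)) {i : Fin n} (h1 : i ≠ D.rowLabel r)
    (h2 : i ≠ D.colLabel c) : i ∈ D.flowSources H V ↔ i ∈ D.flowSources H' V' := by
  rcases D.exists_label i with ⟨a, rfl⟩ | ⟨b, rfl⟩
  · rw [rowLabel_mem_flowSources, rowLabel_mem_flowSources, hH a]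
    exact fun h => h1 (congrArg _ (Fin.ext h))
  · rw [colLabel_mem_flowSources, colLabel_mem_flowSources, hV b]
    exact fun h => h2 (congrArg _ (Fin.ext h))

/-- Adding a box without `+` exchanges two labels. -/
theorem mem_positroid_iff_of_notMem_plus (hmem : ((r : ℕ), (c : ℕ)) ∈ D.shape)
    (hp : (r, c) ∉ D.plus) {I I' : Finset (Fin n)}
    (h : ∀ i, i ∈ I' ↔ Equiv.swap (D.rowLabel r) (D.colLabel c) i ∈ I) :
    I ∈ D.positroid ↔ I' ∈ (D.eraseCorner r c hr hc).positroid := by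
  have hP : ∀ a b, (D.eraseCorner r c hr hc).HasPlus a b ↔ D.HasPlus a b := by
    intro a b
    rw [hasPlus_eraseCorner_iff]
    refine and_iff_left_of_imp ?_
    rintro h1 ⟨rfl, rfl⟩
    exact hp ((D.hasPlus_iff r c).1 h1)
  have hflow : ∀ H V, (D.eraseCorner r c hr hc).IsFlow H V ↔ D.IsFlow H V := by
    intro H V
    constructor
    · intro hf
      exact ⟨hf.left, hf.top, fun a b => by rw [← hP]; exact hf.pass_h a b,
        fun a b => by rw [← hP]; exact hf.pass_v a b, fun a b => by rw [← hP]; exact hf.plus a b⟩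
    · intro hf
      exact ⟨hf.left, hf.top, fun a b => by rw [hP]; exact hf.pass_h a b,
        fun a b => by rw [hP]; exact hf.pass_v a b, fun a b => by rw [hP]; exact hf.plus a b⟩
  rw [mem_positroid_iff, mem_positroid_iff]
  refine exists_congr fun H => exists_congr fun V => and_congr (hflow H V).symm ?_
  simp only [h, mem_flowSources_eraseCorner hmem]
  exact (Equiv.swap (D.rowLabel r) (D.colLabel c)).forall_congr_left.trans (by simp)

/-- Here `e`, `v`, `w`, `s` stand for crossings of the east, north, west and south sides of the
corner box: either no path passes through it, or exactly one does. -/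
theorem plus_cases {e v w s : Prop} (h1 : ¬ (e ∧ v)) (h2 : ¬ (w ∧ s)) (h3 : (e ∨ v) ↔ (w ∨ s)) :
    (¬ e ∧ ¬ s ∧ ¬ w ∧ ¬ v) ∨ ((v ↔ ¬ e) ∧ (¬ w ↔ s)) := by
  tauto

theorem plus_not_not (v w : Prop) :
    ¬ (¬ v ∧ v) ∧ ¬ (w ∧ ¬ w) ∧ ((¬ v ∨ v) ↔ (w ∨ ¬ w)) := by
  tauto

theorem plus_false_false {v w : Prop} (hv : ¬ v) (hw : ¬ w) :
    ¬ (False ∧ v) ∧ ¬ (w ∧ False) ∧ ((False ∨ v) ↔ (w ∨ False)) := by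
  tauto

/-- The effect of adding a box with a `+`. -/
theorem mem_positroid_iff_of_mem_plus (hmem : ((r : ℕ), (c : ℕ)) ∈ D.shape)
    (hp : (r, c) ∈ D.plus) {I I' : Finset (Fin n)}
    (h : ∀ i, i ∈ I' ↔ Equiv.swap (D.rowLabel r) (D.colLabel c) i ∈ I) :
    I ∈ D.positroid ↔ I ∈ (D.eraseCorner r c hr hc).positroid ∨
      (D.rowLabel r ∈ I ∧ D.colLabel c ∉ I ∧ I' ∈ (D.eraseCorner r c hr hc).positroid) := by
  have hP := hasPlus_eraseCorner_iff (D := D) (r := r) (c := c) (hr := hr) (hc := hc)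
  have hrow : ∀ b, D.HasPlus r b → b ≤ c := by
    intro b hb
    have := YoungDiagram.mem_iff_lt_rowLen.1 hb.mem_shape
    rw [rowLen_of_corner hmem hc] at this
    omega
  have hcol : ∀ a, D.HasPlus a c → a ≤ r := by
    intro a ha
    have := YoungDiagram.mem_iff_lt_colLen.1 ha.mem_shape
    rw [colLen_of_corner hmem hr] at this
    omega
  have hne := D.rowLabel_ne_colLabel r c
  have hoff : ∀ i, i ≠ D.rowLabel r → i ≠ D.colLabel c → (i ∈ I' ↔ i ∈ I) := by
    intro i h1 h2
    rw [h, Equiv.swap_apply_of_ne_of_ne h1 h2]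
  have hi' : D.rowLabel r ∈ I' ↔ D.colLabel c ∈ I := by rw [h, Equiv.swap_apply_left]
  have hj' : D.colLabel c ∈ I' ↔ D.rowLabel r ∈ I := by rw [h, Equiv.swap_apply_right]
  have hkr : (r : ℕ) < k := r.2
  have hkc : (c : ℕ) < n - k := c.2
  constructor
  · intro hI
    obtain ⟨H, V, hf, hS⟩ := (D.mem_positroid_iff I).1 hI
    -- With the box gone, the crossings of its west and north sides become border data: `H r c` and
    -- `V r c` are continued straight to the border.
    have hf' := hf.modify (D' := D.eraseCorner r c hr hc) (r := r) (c := c) (e := H r c)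
      (s := V r c) (fun a b hab => by rw [hP, and_iff_left hab]) (fun b hb => hrow b ((hP _ _).1 hb).1)
      (fun a ha => hcol a ((hP _ _).1 ha).1) (fun _ => ⟨Iff.rfl, Iff.rfl⟩)
      (fun h => absurd ⟨rfl, rfl⟩ ((hP _ _).1 h).2)
    obtain ⟨J, hJ, hJS⟩ := mem_positroid_of_isFlow hf'
    obtain ⟨h1, h2, h3⟩ := hf.plus r c ((D.hasPlus_iff r c).2 hp)
    have hiJ : D.rowLabel r ∈ J ↔ V r c := by
      rw [hJS, rowLabel_mem_flowSources_eraseCorner hmem, if_pos ⟨rfl, hkr⟩]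
    have hjJ : D.colLabel c ∈ J ↔ ¬ H r c := by
      rw [hJS, colLabel_mem_flowSources_eraseCorner hmem, if_pos ⟨rfl, hkc⟩]
    have hiI : D.rowLabel r ∈ I ↔ ¬ H r (c + 1) := by
      rw [hS, rowLabel_mem_flowSources, hf.h_eq (Nat.succ_le_of_lt hkc) fun b hb _ hb' =>
        absurd (hrow b ((D.hasPlus_iff _ _).2 hb')) (by omega)]
    have hjI : D.colLabel c ∈ I ↔ V (r + 1) c := by
      rw [hS, colLabel_mem_flowSources, hf.v_eq (Nat.succ_le_of_lt hkr) fun b hb _ hb' =>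
        absurd (hcol b ((D.hasPlus_iff _ _).2 hb')) (by omega)]
    have hJoff : ∀ i, i ≠ D.rowLabel r → i ≠ D.colLabel c → (i ∈ J ↔ i ∈ I) := by
      intro i hi1 hi2
      rw [hJS, hS, mem_flowSources_eraseCorner hmem, Equiv.swap_apply_of_ne_of_ne hi1 hi2]
      exact mem_flowSources_congr (r := r) (c := c) (fun a ha => by rw [if_neg fun h => ha h.1])
        (fun b hb => by rw [if_neg fun h => hb h.1]) hi1 hi2
    -- With no path through the box, `I` and `J` differ by the exchange of the two labels; with one
    -- path, they coincide.
    rcases plus_cases h1 h2 h3 with ⟨he, hs, hw, hv⟩ | ⟨hcase1, hcase2⟩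
    · right
      refine ⟨hiI.2 he, mt hjI.1 hs, ?_⟩
      convert hJ
      ext i
      by_cases hi1 : i = D.rowLabel r
      · subst hi1
        exact iff_of_false (mt (hi'.trans hjI).1 hs) (mt hiJ.1 hv)
      by_cases hi2 : i = D.colLabel c
      · subst hi2
        exact iff_of_true (hj'.2 (hiI.2 he)) (hjJ.2 hw)
      rw [hoff i hi1 hi2, hJoff i hi1 hi2]
    · left
      convert hJ
      ext i
      by_cases hi1 : i = D.rowLabel r
      · subst hi1
        exact hiI.trans (hcase1.symm.trans hiJ.symm)
      by_cases hi2 : i = D.colLabel c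
      · subst hi2
        exact hjI.trans (hcase2.symm.trans hjJ.symm)
      rw [hJoff i hi1 hi2]
  -- Conversely, a flow of the smaller diagram extends over the box by any east and south values
  -- `e`, `s` that satisfy the condition at the `+`.
  · have key : ∀ (H V : ℕ → ℕ → Prop) (e s : Prop), (D.eraseCorner r c hr hc).IsFlow H V →
        (¬ (e ∧ V r c) ∧ ¬ (H r c ∧ s) ∧ ((e ∨ V r c) ↔ (H r c ∨ s))) →
        (D.rowLabel r ∈ I ↔ ¬ e) → (D.colLabel c ∈ I ↔ s) →
        (∀ i, i ≠ D.rowLabel r → i ≠ D.colLabel c →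
          (i ∈ I ↔ i ∈ (D.eraseCorner r c hr hc).flowSources H V)) → I ∈ D.positroid := by
      intro H V e s hf hes hi hj hI
      have hf' := hf.modify (D' := D) (r := r) (c := c) (e := e) (s := s)
        (fun a b hab => by rw [hP, and_iff_left hab]) hrow hcol
        (fun h => absurd ((D.hasPlus_iff r c).2 hp) h) (fun _ => hes)
      refine (D.mem_positroid_iff I).2 ⟨_, _, hf', fun i => ?_⟩
      by_cases hi1 : i = D.rowLabel r
      · subst hi1
        rw [hi, rowLabel_mem_flowSources, if_pos ⟨rfl, hkc⟩]
      by_cases hi2 : i = D.colLabel c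
      · subst hi2
        rw [hj, colLabel_mem_flowSources, if_pos ⟨rfl, hkr⟩]
      rw [hI i hi1 hi2, mem_flowSources_eraseCorner hmem, Equiv.swap_apply_of_ne_of_ne hi1 hi2]
      exact (mem_flowSources_congr (r := r) (c := c) (fun a ha => by rw [if_neg fun h => ha h.1])
        (fun b hb => by rw [if_neg fun h => hb h.1]) hi1 hi2).symm
    have hends : ∀ H V, (D.eraseCorner r c hr hc).IsFlow H V →
        (H r (n - k) ↔ H r c) ∧ (V k c ↔ V r c) := by
      intro H V hf
      constructor
      · refine hf.h_eq hkc.le fun b hb _ hb' => ?_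
        have h1 := (hP _ _).1 ((hasPlus_iff _ _ _).2 hb')
        have := hrow b h1.1
        exact h1.2 ⟨rfl, by omega⟩
      · refine hf.v_eq hkr.le fun b hb _ hb' => ?_
        have h1 := (hP _ _).1 ((hasPlus_iff _ _ _).2 hb')
        have := hcol b h1.1
        exact h1.2 ⟨by omega, rfl⟩
    rintro (hI | ⟨h1, h2, hI⟩)
    · obtain ⟨H, V, hf, hS⟩ := (mem_positroid_iff _ _).1 hI
      obtain ⟨e1, e2⟩ := hends H V hf
      -- These values force exactly one path through the box and leave the membership of both labels
      -- unchanged.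
      refine key H V (¬ V r c) (¬ H r c) hf (plus_not_not _ _) ?_ ?_ fun i _ _ => hS i
      · rw [hS, rowLabel_mem_flowSources_eraseCorner hmem, e2, not_not]
      · rw [hS, colLabel_mem_flowSources_eraseCorner hmem, e1]
    · obtain ⟨H, V, hf, hS⟩ := (mem_positroid_iff _ _).1 hI
      obtain ⟨e1, e2⟩ := hends H V hf
      have h3 := hS (D.rowLabel r)
      have h4 := hS (D.colLabel c)
      rw [hi', rowLabel_mem_flowSources_eraseCorner hmem, e2] at h3
      rw [hj', colLabel_mem_flowSources_eraseCorner hmem, e1] at h4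
      refine key H V False False hf (plus_false_false (mt h3.2 h2) (h4.1 h1))
        (iff_of_true h1 not_false) (iff_of_false h2 not_false) fun i hi1 hi2 => ?_
      rw [← hS, hoff i hi1 hi2]

/-- If the corner box contains no `+`, then its column or its row contains no `+` at all. -/
theorem notMem_or_mem_of_notMem_plus (hmem : ((r : ℕ), (c : ℕ)) ∈ D.shape)
    (hp : (r, c) ∉ D.plus) {I : Finset (Fin n)}
    (hI : I ∈ (D.eraseCorner r c hr hc).positroid) : D.rowLabel r ∉ I ∨ D.colLabel c ∈ I := by
  have hi := colLabel_eraseCorner (hr := hr) (hc := hc) hmem c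
  have hj := rowLabel_eraseCorner (hr := hr) (hc := hc) hmem r
  rw [Equiv.swap_apply_right] at hi
  rw [Equiv.swap_apply_left] at hj
  have hor : (∀ a, (a, c) ∉ D.plus) ∨ ∀ b, (r, b) ∉ D.plus := by
    by_contra hcon
    push Not at hcon
    obtain ⟨⟨a, ha⟩, b, hb⟩ := hcon
    have h1 := YoungDiagram.mem_iff_lt_colLen.1 (D.plus_sub _ ha)
    have h2 := YoungDiagram.mem_iff_lt_rowLen.1 (D.plus_sub _ hb)
    simp only [rowLen_of_corner hmem hc, colLen_of_corner hmem hr] at h1 h2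
    have h3 : a ≠ r := by rintro rfl; exact hp ha
    have h4 : b ≠ c := by rintro rfl; exact hp hb
    refine hp (D.le_property r a c b hmem (lt_of_le_of_ne ?_ h3) (lt_of_le_of_ne ?_ h4) ha hb)
    · exact Fin.le_def.2 (by omega)
    · exact Fin.le_def.2 (by omega)
  rcases hor with h | h
  · left
    rw [← hi]
    exact colLabel_notMem_of_mem_positroid _ (fun a ha => h a (Finset.mem_of_mem_erase ha)) hI
  · right
    rw [← hj]
    exact rowLabel_mem_of_mem_positroid _ (fun a ha => h a (Finset.mem_of_mem_erase ha)) hI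

end EraseCorner

/-! ### Nonemptiness of the cell -/

/-- The Plücker coordinates of `A` are positive on `M` and zero elsewhere. -/
def _root_.HasCell (A : Matrix (Fin k) (Fin n) ℝ) (M : Set (Finset (Fin n))) : Prop :=
  ∀ I, (I.1 ∈ M → 0 < plucker A I) ∧ (I.1 ∉ M → plucker A I = 0)

theorem _root_.HasCell.nonneg {A : Matrix (Fin k) (Fin n) ℝ} {M : Set (Finset (Fin n))}
    (h : HasCell A M) (I) : 0 ≤ plucker A I := by
  by_cases hI : I.1 ∈ M
  · exact ((h I).1 hI).le
  · exact ((h I).2 hI).ge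

/-- Without boxes the row labels form the only basis, and the matrix with unit columns at these
labels represents the cell. -/
theorem exists_hasCell_of_shape_empty (D : LeDiagram k n) (hD : D.shape.cells = ∅) :
    (∃ A : Matrix (Fin k) (Fin n) ℝ, HasCell A D.positroid) ∧ ∀ I ∈ D.positroid, I.card = k := by
  have hno : ∀ p, p ∉ D.plus := by
    intro p hp
    have := D.plus_sub p hp
    rw [← YoungDiagram.mem_cells, hD] at this
    simp at this
  have hM : ∀ I, I ∈ D.positroid ↔ I = Finset.univ.image D.rowLabel := by
    have h1 : ∀ I ∈ D.positroid, I = Finset.univ.image D.rowLabel := by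
      intro I hI
      ext i
      rcases D.exists_label i with ⟨r, rfl⟩ | ⟨c, rfl⟩
      · simp [D.rowLabel_mem_of_mem_positroid (fun c => hno _) hI]
      · simp [D.colLabel_notMem_of_mem_positroid (fun c => hno _) hI, D.rowLabel_ne_colLabel]
    intro I
    refine ⟨h1 I, ?_⟩
    rintro rfl
    obtain ⟨J, hJ, -⟩ := mem_positroid_of_isFlow D.isFlow_false
    rwa [← h1 J hJ]
  have hcard : (Finset.univ.image D.rowLabel).card = k := by
    rw [Finset.card_image_of_injective _ D.rowLabel_strictMono.injective]; simp
  refine ⟨⟨of fun r i => if D.rowLabel r = i then 1 else 0, fun I => ⟨fun hI => ?_, fun hI => ?_⟩⟩,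
    fun I hI => by rw [(hM I).1 hI, hcard]⟩
  · rw [hM] at hI
    have : D.rowLabel = I.1.orderEmbOfFin I.2 :=
      Finset.orderEmbOfFin_unique I.2 (fun r => by rw [hI]; simp) D.rowLabel_strictMono
    rw [plucker, ← this]
    have h1 : (of fun r i => if D.rowLabel r = i then (1 : ℝ) else 0).submatrix id D.rowLabel = 1 := by
      ext a b
      simp [one_apply, D.rowLabel_strictMono.injective.eq_iff]
    rw [h1, det_one]
    exact one_pos
  · rw [hM] at hI
    have : ∃ i ∈ I.1, i ∉ Finset.univ.image D.rowLabel := by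
      by_contra hcon
      push Not at hcon
      exact hI (Finset.eq_of_subset_of_card_le hcon (by rw [hcard, I.2]))
    obtain ⟨i, hi, hi'⟩ := this
    obtain ⟨p, rfl⟩ := exists_orderEmbOfFin_eq I.2 hi
    refine det_eq_zero_of_column_eq_zero p fun a => ?_
    rw [submatrix_apply, of_apply, if_neg]
    exact fun h => hi' (by simp [← h])

/-- The finset `I` with two labels exchanged. -/
theorem _root_.exists_swap_finset (I : {I : Finset (Fin n) // I.card = k}) (i j : Fin n) :
    ∃ I' : {I : Finset (Fin n) // I.card = k}, ∀ x, x ∈ I'.1 ↔ Equiv.swap i j x ∈ I.1 := by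
  refine ⟨⟨I.1.map (Equiv.swap i j).toEmbedding, by rw [Finset.card_map, I.2]⟩, fun x => ?_⟩
  simp [Finset.mem_map_equiv]

/-- The positroid cell of a Le-diagram is not empty, and its positroid has rank `k`. -/
theorem exists_hasCell (D : LeDiagram k n) :
    (∃ A : Matrix (Fin k) (Fin n) ℝ, HasCell A D.positroid) ∧ ∀ I ∈ D.positroid, I.card = k := by
  induction hN : D.shape.cells.card generalizing D with
  | zero => exact D.exists_hasCell_of_shape_empty (Finset.card_eq_zero.1 hN)
  | succ N ih =>
    obtain ⟨r, c, hmem, hr, hc⟩ : ∃ (r : Fin k) (c : Fin (n - k)), ((r : ℕ), (c : ℕ)) ∈ D.shape ∧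
        ((r : ℕ) + 1, (c : ℕ)) ∉ D.shape ∧ ((r : ℕ), (c : ℕ) + 1) ∉ D.shape := by
      obtain ⟨⟨a, b⟩, hab⟩ := Finset.card_pos.1 (by omega : 0 < D.shape.cells.card)
      rw [YoungDiagram.mem_cells] at hab
      have h1 := YoungDiagram.mem_iff_lt_rowLen.1 hab
      -- A corner: go to the last box of a row, then to the bottom of that box's column.
      have h2 : (a, D.shape.rowLen a - 1) ∈ D.shape := YoungDiagram.mem_iff_lt_rowLen.2 (by omega)
      have h3 := YoungDiagram.mem_iff_lt_colLen.1 h2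
      have h4 : (D.shape.colLen (D.shape.rowLen a - 1) - 1, D.shape.rowLen a - 1) ∈ D.shape :=
        YoungDiagram.mem_iff_lt_colLen.2 (by omega)
      have h5 := D.shape_sub _ h4
      refine ⟨⟨_, h5.1⟩, ⟨_, h5.2⟩, h4, ?_, ?_⟩
      · rw [YoungDiagram.mem_iff_lt_colLen]
        simp only
        omega
      · intro h6
        have h7 := D.shape.up_left_mem (i1 := a) (by simp only; omega) le_rfl h6
        rw [YoungDiagram.mem_iff_lt_rowLen] at h7
        simp only at h7
        omega
    obtain ⟨⟨A, hA⟩, hcard⟩ := ih (D.eraseCorner r c hr hc) (by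
      change (D.shape.cells.erase (↑r, ↑c)).card = N
      rw [Finset.card_erase_of_mem hmem, hN, Nat.add_sub_cancel])
    have hij := D.colLabel_of_corner hmem hr hc
    have hne := D.rowLabel_ne_colLabel r c
    have hcard' : ∀ I : Finset (Fin n), ∃ I' : Finset (Fin n), I'.card = I.card ∧
        ∀ x, x ∈ I' ↔ Equiv.swap (D.rowLabel r) (D.colLabel c) x ∈ I := by
      intro I
      obtain ⟨I', h⟩ := exists_swap_finset (⟨I, rfl⟩ : {J : Finset (Fin n) // J.card = I.card})
        (D.rowLabel r) (D.colLabel c)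
      exact ⟨I'.1, I'.2, h⟩
    by_cases hp : (r, c) ∈ D.plus
    -- The minor of `I` becomes the sum of the old minors of `I` and `I'` when `I` contains only the
    -- row label of the two, and is otherwise unchanged. Sums of nonnegative numbers do not cancel,
    -- so the support follows `mem_positroid_iff_of_mem_plus`.
    · refine ⟨⟨A.updateCol (D.rowLabel r) fun s => A s (D.rowLabel r) + A s (D.colLabel c),
        fun I => ?_⟩, fun I hI => ?_⟩
      · obtain ⟨I', hI'⟩ := exists_swap_finset I (D.rowLabel r) (D.colLabel c)
        have hiff := mem_positroid_iff_of_mem_plus (hr := hr) (hc := hc) hmem hp hI'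
        by_cases hi : D.rowLabel r ∈ I.1
        · by_cases hj : D.colLabel c ∈ I.1
          · rw [plucker_addCol_of_mem A hne hi hj, hiff]
            simpa [hj] using hA I
          · rw [plucker_addCol_of_mem_notMem A hij hi hj hI', hiff]
            simp only [hi, hj, not_false_eq_true, true_and]
            constructor
            · rintro (h | h)
              · exact add_pos_of_pos_of_nonneg ((hA I).1 h) (hA.nonneg _)
              · exact add_pos_of_nonneg_of_pos (hA.nonneg _) ((hA I').1 h)
            · intro h
              rw [not_or] at h
              rw [(hA I).2 h.1, (hA I').2 h.2, add_zero]
        · rw [plucker_addCol_of_notMem A _ hi, hiff]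
          simpa [hi] using hA I
      · obtain ⟨I', h1, hI'⟩ := hcard' I
        rcases (mem_positroid_iff_of_mem_plus (hr := hr) (hc := hc) hmem hp hI').1 hI with h | h
        · exact hcard _ h
        · rw [← h1]
          exact hcard _ h.2.2
    -- Negating one column after the exchange repairs the sign when `I` contains both labels. It
    -- would spoil the sign when `I` contains only the column label, but then the Le-property makes
    -- the minor vanish.
    · refine ⟨⟨A.submatrix id (Equiv.swap (D.rowLabel r) (D.colLabel c)) *
        diagonal (fun x => if x = D.colLabel c then (-1 : ℝ) else 1), fun I => ?_⟩, fun I hI => ?_⟩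
      · obtain ⟨I', hI'⟩ := exists_swap_finset I (D.rowLabel r) (D.colLabel c)
        have hiff := mem_positroid_iff_of_notMem_plus (hr := hr) (hc := hc) hmem hp hI'
        have hi' : D.rowLabel r ∈ I'.1 ↔ D.colLabel c ∈ I.1 := by rw [hI', Equiv.swap_apply_left]
        have hj' : D.colLabel c ∈ I'.1 ↔ D.rowLabel r ∈ I.1 := by rw [hI', Equiv.swap_apply_right]
        rw [plucker_mul_diagonal, Finset.prod_ite_eq', hiff]
        by_cases hj : D.colLabel c ∈ I.1
        · rw [if_pos hj, neg_one_mul]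
          by_cases hi : D.rowLabel r ∈ I.1
          · have : I' = I := by
              apply Subtype.ext
              ext x
              by_cases hx : x = D.rowLabel r
              · subst hx; tauto
              by_cases hx' : x = D.colLabel c
              · subst hx'; tauto
              rw [hI', Equiv.swap_apply_of_ne_of_ne hx hx']
            rw [plucker_swapCol_of_mem A hne hi hj, neg_neg, this]
            exact hA I
          · have hI'M : I'.1 ∉ (D.eraseCorner r c hr hc).positroid := by
              intro h
              rcases notMem_or_mem_of_notMem_plus (hr := hr) (hc := hc) hmem hp h with h | h
              · exact h (hi'.2 hj)
              · exact hi (hj'.1 h)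
            rw [plucker_swapCol A hij (Or.inl hi) hI', (hA I').2 hI'M]
            simp [hI'M]
        · rw [if_neg hj, one_mul, plucker_swapCol A hij (Or.inr hj) hI']
          exact hA I'
      · obtain ⟨I', h1, hI'⟩ := hcard' I
        rw [← h1]
        exact hcard _ ((mem_positroid_iff_of_notMem_plus (hr := hr) (hc := hc) hmem hp hI').1 hI)

end LeDiagram

/-! ### Vectors of `W` orthogonal to a point of the cell -/

section Cells

variable {k m n : ℕ}

theorem Represents.mem_iff {A : Matrix (Fin m) (Fin n) ℝ}
    {V : Submodule ℝ (EuclideanSpace ℝ (Fin n))} (h : Represents A V)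
    (w : EuclideanSpace ℝ (Fin n)) : w ∈ V ↔ ∃ l : Fin m → ℝ, w.ofLp = Aᵀ *ᵥ l := by
  rw [← h.2, Submodule.mem_span_range_iff_exists_fun]
  refine exists_congr fun l => ?_
  have : (∑ i, l i • (WithLp.toLp 2 (A i) : EuclideanSpace ℝ (Fin n))).ofLp = Aᵀ *ᵥ l := by
    ext x
    simp [mulVec, dotProduct, mul_comm]
  rw [← this]
  constructor
  · rintro rfl; rfl
  · intro h; exact (WithLp.ofLp_injective 2 h).symm

theorem Represents.mem_orthogonal_iff {A : Matrix (Fin m) (Fin n) ℝ}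
    {V : Submodule ℝ (EuclideanSpace ℝ (Fin n))} (h : Represents A V)
    (w : EuclideanSpace ℝ (Fin n)) : w ∈ Vᗮ ↔ A *ᵥ w.ofLp = 0 := by
  rw [← h.2, Submodule.mem_orthogonal]
  have hrow : ∀ i, inner ℝ (WithLp.toLp 2 (A i) : EuclideanSpace ℝ (Fin n)) w = (A *ᵥ w.ofLp) i := by
    intro i
    simp [PiLp.inner_apply, mulVec, dotProduct, mul_comm]
  constructor
  · intro hw
    ext i
    rw [← hrow]
    exact hw _ (Submodule.subset_span ⟨i, rfl⟩)
  · intro hw u hu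
    induction hu using Submodule.span_induction with
    | mem x hx => obtain ⟨i, rfl⟩ := hx; simp only [hrow, hw, Pi.zero_apply]
    | zero => simp
    | add x y _ _ hx hy => rw [inner_add_left, hx, hy, add_zero]
    | smul a x _ hx => rw [inner_smul_left, hx, mul_zero]

/-- Writing `w = Cᵀ l`, the condition becomes `(Q * Cᵀ) l = 0`. -/
theorem eq_zero_of_det_ne_zero {Q C : Matrix (Fin m) (Fin n) ℝ}
    {W : Submodule ℝ (EuclideanSpace ℝ (Fin n))} (hC : Represents C W) (hdet : (Q * Cᵀ).det ≠ 0)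
    {w : EuclideanSpace ℝ (Fin n)} (hw : w ∈ W) (h : Q *ᵥ w.ofLp = 0) : w = 0 := by
  obtain ⟨l, hl⟩ := (hC.mem_iff w).1 hw
  rw [hl, mulVec_mulVec] at h
  have := eq_zero_of_mulVec_eq_zero hdet h
  subst this
  rw [mulVec_zero] at hl
  exact WithLp.ofLp_injective 2 hl

theorem consUnitRow_mulVec_eq_zero {A : Matrix (Fin k) (Fin n) ℝ} {v : Fin n → ℝ} {i : Fin n}
    (hi : v i = 0) (hA : A *ᵥ v = 0) : consUnitRow i A *ᵥ v = 0 := by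
  ext s
  refine Fin.cases ?_ (fun s => ?_) s
  · simp [mulVec, dotProduct, consUnitRow_zero, hi]
  · exact congrFun hA s

theorem exists_insert_finset {i : Fin n} {I : {I : Finset (Fin n) // I.card = k}} (hi : i ∉ I.1) :
    ∃ J : {J : Finset (Fin n) // J.card = k + 1}, i ∈ J.1 ∧ I.1 = J.1.erase i :=
  ⟨⟨insert i I.1, by rw [Finset.card_insert_of_notMem hi, I.2]⟩, Finset.mem_insert_self _ _,
    (Finset.erase_insert hi).symm⟩

theorem exists_erase_finset {i : Fin n} {J : {J : Finset (Fin n) // J.card = k + 1}} (hi : i ∈ J.1) :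
    ∃ I : {I : Finset (Fin n) // I.card = k}, I.1 = J.1.erase i :=
  ⟨⟨J.1.erase i, by rw [Finset.card_erase_of_mem hi, J.2, Nat.add_sub_cancel]⟩, rfl⟩

variable {A : Matrix (Fin k) (Fin n) ℝ} {C : Matrix (Fin (k + 1)) (Fin n) ℝ}
  {M : Set (Finset (Fin n))} {W : Submodule ℝ (EuclideanSpace ℝ (Fin n))}

/-- The Cauchy–Binet expansion at the first element which is not in every basis is positive. -/
theorem HasCell.det_consUnitRow_ne_zero (hA : HasCell A M) (hC : ∀ J, 0 < plucker C J) {j : Fin n}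
    (hlt : ∀ I ∈ M, ∀ i < j, i ∈ I) {I₀ : {I : Finset (Fin n) // I.card = k}} (hI₀ : I₀.1 ∈ M)
    (hj : j ∉ I₀.1) : (consUnitRow j A * Cᵀ).det ≠ 0 := by
  have hterm : ∀ I : {I : Finset (Fin n) // I.card = k}, ∀ J : {J : Finset (Fin n) // J.card = k + 1},
      j ∈ J.1 → I.1 = J.1.erase j →
        (-1) ^ (j : ℕ) * plucker (consUnitRow j A) J = plucker A I := by
    intro I J hjJ hIJ
    rw [plucker_consUnitRow_of_mem A hjJ hIJ]
    by_cases hI : I.1 ∈ M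
    · have : I.1.filter (· < j) = Finset.Iio j := by
        ext x
        simp only [Finset.mem_filter, Finset.mem_Iio, and_iff_right_iff_imp]
        exact hlt _ hI x
      rw [this, Fin.card_Iio, ← mul_assoc, ← mul_pow]
      simp
    · rw [(hA I).2 hI, mul_zero, mul_zero]
  have hpos : 0 < (-1) ^ (j : ℕ) * (consUnitRow j A * Cᵀ).det := by
    rw [plucker_cauchyBinet, Finset.mul_sum]
    refine Finset.sum_pos' (fun J _ => ?_) ?_
    · rw [← mul_assoc]
      refine mul_nonneg ?_ (hC J).le
      by_cases hjJ : j ∈ J.1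
      · obtain ⟨I, hI⟩ := exists_erase_finset hjJ
        rw [hterm I J hjJ hI]
        exact hA.nonneg I
      · rw [plucker_consUnitRow_of_notMem j A hjJ, mul_zero]
    · obtain ⟨J, hjJ, hI⟩ := exists_insert_finset hj
      refine ⟨J, Finset.mem_univ _, ?_⟩
      rw [← mul_assoc, hterm I₀ J hjJ hI]
      exact mul_pos ((hA I₀).1 hI₀) (hC J)
  exact fun h => by simp [h] at hpos

/-- A coordinate which is in every basis vanishes on the orthogonal complement. -/
theorem HasCell.coord_eq_zero (hA : HasCell A M) {I₀ : {I : Finset (Fin n) // I.card = k}}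
    (hI₀ : I₀.1 ∈ M) {i : Fin n} (hi : ∀ I ∈ M, i ∈ I) {v : Fin n → ℝ} (hv : A *ᵥ v = 0) :
    v i = 0 := by
  -- `B` is `A` with `v` adjoined as first row. The determinant of `consUnitRow i A * Bᵀ` is
  -- computed twice: Cauchy–Binet gives `0`, as a nonzero term would need a basis without `i`;
  -- expansion along the first column, which is `(v i, A v) = (v i, 0)`, gives `v i` times the
  -- positive number `det (A * Aᵀ)`.
  let B : Matrix (Fin (k + 1)) (Fin n) ℝ :=
    of fun r l => Fin.cons (α := fun _ => ℝ) (v l) (fun s => A s l) r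
  have h1 : (consUnitRow i A * Bᵀ).det = 0 := by
    rw [plucker_cauchyBinet]
    refine Finset.sum_eq_zero fun J _ => ?_
    by_cases hiJ : i ∈ J.1
    · obtain ⟨I, hI⟩ := exists_erase_finset hiJ
      rw [plucker_consUnitRow_of_mem A hiJ hI, (hA I).2, mul_zero, zero_mul]
      intro h
      have := hi _ h
      rw [hI] at this
      simp at this
    · rw [plucker_consUnitRow_of_notMem i A hiJ, zero_mul]
  have h2 : (consUnitRow i A * Bᵀ).det = v i * (A * Aᵀ).det := by
    rw [det_succ_column_zero, Fin.sum_univ_succ, Finset.sum_eq_zero, add_zero]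
    · have e1 : (consUnitRow i A * Bᵀ) 0 0 = v i := by
        simp [mul_apply, consUnitRow_zero, B]
      rw [e1]
      simp only [Fin.val_zero, pow_zero, one_mul]
      rfl
    · intro s _
      have e2 : (consUnitRow i A * Bᵀ) s.succ 0 = 0 := congrFun hv s
      rw [e2]
      simp
  have h3 : 0 < (A * Aᵀ).det := by
    rw [plucker_cauchyBinet]
    refine Finset.sum_pos' (fun J _ => mul_self_nonneg _) ⟨I₀, Finset.mem_univ _, ?_⟩
    exact mul_pos ((hA I₀).1 hI₀) ((hA I₀).1 hI₀)
  rw [h1] at h2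
  exact (mul_eq_zero.1 h2.symm).resolve_right h3.ne'

theorem HasCell.mul_diagonal (hA : HasCell A M) {t : Fin n → ℝ} (ht : ∀ i, 0 < t i) :
    HasCell (A * diagonal t) M := by
  intro I
  rw [plucker_mul_diagonal]
  exact ⟨fun h => mul_pos (Finset.prod_pos fun i _ => ht i) ((hA I).1 h),
    fun h => by rw [(hA I).2 h, mul_zero]⟩

/-- Being in the cell only depends on the signs of a vector in the orthogonal complement. -/
theorem HasCell.exists_of_sign (hA : HasCell A M) {v v' : Fin n → ℝ} (hv : A *ᵥ v = 0)
    (h : ∀ i, 0 < v i * v' i ∨ (v i = 0 ∧ v' i = 0)) :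
    ∃ A' : Matrix (Fin k) (Fin n) ℝ, HasCell A' M ∧ A' *ᵥ v' = 0 := by
  -- This `t` satisfies `diagonal t *ᵥ v' = v`; where both vectors vanish any positive value will
  -- do.
  let t : Fin n → ℝ := fun i => if v' i = 0 then 1 else v i / v' i
  refine ⟨A * diagonal t, hA.mul_diagonal fun i => ?_, ?_⟩
  · simp only [t]
    split_ifs with h0
    · exact one_pos
    · rcases h i with h1 | h1
      · have : v i / v' i = v i * v' i / (v' i * v' i) := by field_simp
        rw [this]
        exact div_pos h1 (mul_self_pos.2 h0)
      · exact absurd h1.2 h0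
  · have htv : diagonal t *ᵥ v' = v := by
      ext i
      rw [mulVec_diagonal]
      simp only [t]
      split_ifs with h0
      · rcases h i with h1 | h1
        · simp [h0] at h1
        · rw [h1.1, h1.2, mul_zero]
      · field_simp
    rw [← mulVec_mulVec, htv, hv]

theorem exists_mem_mulVec_eq_zero (hW : Module.finrank ℝ W = k + 1)
    (A : Matrix (Fin k) (Fin n) ℝ) : ∃ w ∈ W, w ≠ 0 ∧ A *ᵥ w.ofLp = 0 := by
  let f : W →ₗ[ℝ] (Fin k → ℝ) :=
    A.mulVecLin ∘ₗ (WithLp.linearEquiv 2 ℝ (Fin n → ℝ)).toLinearMap ∘ₗ W.subtype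
  have hf : LinearMap.ker f ≠ ⊥ := LinearMap.ker_ne_bot_of_finrank_lt (by simp [hW])
  obtain ⟨w, hw, hne⟩ := (Submodule.ne_bot_iff _).1 hf
  exact ⟨w, w.2, by simpa using hne, hw⟩

/-- For a generic rescaling of the columns, none of the given determinants vanishes. -/
theorem exists_diagonal_det_ne_zero {ι : Type*} (s : Finset ι)
    (Q : ι → Matrix (Fin m) (Fin n) ℝ) (C : Matrix (Fin m) (Fin n) ℝ)
    (h : ∀ i ∈ s, ∃ J, plucker (Q i) J * plucker C J ≠ 0) :
    ∃ t : Fin n → ℝ, (∀ l, 0 < t l) ∧ ∀ i ∈ s, (Q i * diagonal t * Cᵀ).det ≠ 0 := by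
  let p : ι → MvPolynomial (Fin n) ℝ := fun i =>
    ∑ J, MvPolynomial.C (plucker (Q i) J * plucker C J) * ∏ l ∈ J.1, MvPolynomial.X l
  have hp : ∀ i t, MvPolynomial.eval t (p i) = (Q i * diagonal t * Cᵀ).det := by
    intro i t
    rw [plucker_cauchyBinet, map_sum]
    refine Finset.sum_congr rfl fun J _ => ?_
    rw [plucker_mul_diagonal]
    simp only [map_mul, map_prod, MvPolynomial.eval_C, MvPolynomial.eval_X]
    ring
  have hne : ∏ i ∈ s, p i ≠ 0 := by
    refine Finset.prod_ne_zero_iff.2 fun i hi h0 => ?_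
    obtain ⟨J, hJ⟩ := h i hi
    -- Evaluation at the indicator function of `J` isolates the coefficient of `J`, because all the
    -- index sets have the same size.
    have h1 := hp i (fun l => if l ∈ J.1 then 1 else 0)
    rw [h0, map_zero, plucker_cauchyBinet, Finset.sum_eq_single J] at h1
    · rw [plucker_mul_diagonal, Finset.prod_congr rfl fun l hl => if_pos hl] at h1
      simp only [Finset.prod_const_one, one_mul] at h1
      exact hJ h1.symm
    · intro J' _ hJ'
      have : ∃ l ∈ J'.1, l ∉ J.1 := by
        by_contra hcon
        push Not at hcon
        exact hJ' (Subtype.ext (Finset.eq_of_subset_of_card_le hcon (by rw [J.2, J'.2])))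
      obtain ⟨l, hl, hl'⟩ := this
      rw [plucker_mul_diagonal, Finset.prod_eq_zero hl (if_neg hl'), zero_mul, zero_mul]
    · simp
  by_contra hcon
  push Not at hcon
  -- A polynomial vanishing on the positive orthant is zero.
  refine hne (MvPolynomial.funext_set (fun _ => Set.Ioi 0) (fun _ => Set.Ioi_infinite 0) ?_)
  intro t ht
  obtain ⟨i, hi, hi0⟩ := hcon t fun l => ht l trivial
  rw [map_zero, map_prod]
  exact Finset.prod_eq_zero hi (by rw [hp, hi0])

/-- A generic point of the cell has a vector in its orthogonal complement in `W` whose coordinates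
vanish only where they have to. -/
theorem HasCell.exists_generic (hA : HasCell A M) (hC : ∀ J, 0 < plucker C J) (hW : Represents C W)
    (s : Finset (Fin n))
    (hs : ∀ i ∈ s, ∃ I : {I : Finset (Fin n) // I.card = k}, I.1 ∈ M ∧ i ∉ I.1) :
    ∃ A' : Matrix (Fin k) (Fin n) ℝ, HasCell A' M ∧
      ∃ w ∈ W, A' *ᵥ w.ofLp = 0 ∧ ∀ i ∈ s, w i ≠ 0 := by
  -- The determinant for `i` is nonzero as soon as some basis avoids `i`; it then forbids a nonzero
  -- solution in `W` with vanishing coordinate `i`.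
  obtain ⟨t, ht, hdet⟩ := exists_diagonal_det_ne_zero s (fun i => consUnitRow i A) C (by
    intro i hi
    obtain ⟨I, hI, hiI⟩ := hs i hi
    obtain ⟨J, hiJ, hIJ⟩ := exists_insert_finset hiI
    refine ⟨J, mul_ne_zero ?_ (hC J).ne'⟩
    rw [plucker_consUnitRow_of_mem A hiJ hIJ]
    exact mul_ne_zero (pow_ne_zero _ (by norm_num)) ((hA I).1 hI).ne')
  obtain ⟨w, hw, hne, hw0⟩ := exists_mem_mulVec_eq_zero hW.1 (A * diagonal t)
  refine ⟨_, hA.mul_diagonal ht, w, hw, hw0, fun i hi h0 => hne ?_⟩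
  refine eq_zero_of_det_ne_zero hW (hdet i hi) hw ?_
  rw [← mulVec_mulVec]
  refine consUnitRow_mulVec_eq_zero ?_ (by rw [mulVec_mulVec, hw0])
  rw [mulVec_diagonal, h0, mul_zero]

/-- The vectors whose coordinates in `S` vanish. -/
def coordKer (S : Finset (Fin n)) : Submodule ℝ (EuclideanSpace ℝ (Fin n)) where
  carrier := {w | ∀ i ∈ S, w i = 0}
  add_mem' ha hb i hi := by simp [ha i hi, hb i hi]
  zero_mem' i _ := rfl
  smul_mem' a w hw i hi := by simp [hw i hi]

theorem mem_coordKer {S : Finset (Fin n)} {w : EuclideanSpace ℝ (Fin n)} :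
    w ∈ coordKer S ↔ ∀ i ∈ S, w i = 0 := Iff.rfl

/-- Any `m` coordinates form a coordinate system on `W`, since the corresponding minor is nonzero.
Extending `S` to such a set `J` shows that restriction to the coordinates in `S` is onto. -/
theorem finrank_inf_coordKer {C : Matrix (Fin m) (Fin n) ℝ} (hC : ∀ J, 0 < plucker C J)
    (hW : Represents C W) {S : Finset (Fin n)} (hS : S.card ≤ m) :
    Module.finrank ℝ (W ⊓ coordKer S : Submodule ℝ (EuclideanSpace ℝ (Fin n))) + S.card = m := by
  have hmn : m ≤ n := by
    have := Submodule.finrank_le W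
    rw [hW.1] at this
    simpa using this
  let f : (S : Finset (Fin n)) → W →ₗ[ℝ] (S → ℝ) := fun S =>
    LinearMap.pi fun i => (EuclideanSpace.proj i.1 : _ →L[ℝ] ℝ).toLinearMap ∘ₗ W.subtype
  have hker : ∀ S, LinearMap.ker (f S) = (coordKer S).comap W.subtype := by
    intro S
    ext w
    rw [LinearMap.mem_ker, funext_iff, Submodule.mem_comap, mem_coordKer]
    exact ⟨fun h i hi => h ⟨i, hi⟩, fun h i => h i.1 i.2⟩
  obtain ⟨J, hSJ, hJ⟩ := Finset.exists_superset_card_eq hS (by simpa using hmn)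
  have hinj : Function.Injective (f J) := by
    rw [← LinearMap.ker_eq_bot, hker, Submodule.eq_bot_iff]
    rintro ⟨w, hw⟩ h
    rw [Submodule.mem_comap, mem_coordKer] at h
    obtain ⟨l, hl⟩ := (hW.mem_iff w).1 hw
    have hdet : (C.submatrix id (J.orderEmbOfFin hJ))ᵀ.det ≠ 0 := by
      rw [det_transpose]
      exact (hC ⟨J, hJ⟩).ne'
    have hl0 : l = 0 := eq_zero_of_mulVec_eq_zero hdet (by
      ext b
      exact (congrFun hl (J.orderEmbOfFin hJ b)).symm.trans (h _ (J.orderEmbOfFin_mem hJ b)))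
    subst hl0
    rw [mulVec_zero] at hl
    exact Subtype.ext (WithLp.ofLp_injective 2 hl)
  have hsurjJ : Function.Surjective (f J) :=
    (LinearMap.injective_iff_surjective_of_finrank_eq_finrank (by
      rw [hW.1, Module.finrank_fintype_fun_eq_card, Fintype.card_coe, hJ])).1 hinj
  have hsurj : Function.Surjective (f S) := by
    intro y
    obtain ⟨w, hw⟩ := hsurjJ fun i => if h : i.1 ∈ S then y ⟨i.1, h⟩ else 0
    refine ⟨w, ?_⟩
    ext i
    have := congrFun hw ⟨i.1, hSJ i.2⟩
    simp only [i.2, dif_pos] at this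
    exact this
  have h1 := LinearMap.finrank_range_add_finrank_ker (f S)
  rw [LinearMap.range_eq_top.2 hsurj, finrank_top, Module.finrank_fintype_fun_eq_card,
    Fintype.card_coe, hW.1, hker] at h1
  have h2 : Module.finrank ℝ ((coordKer S).comap W.subtype) =
      Module.finrank ℝ (W ⊓ coordKer S : Submodule ℝ (EuclideanSpace ℝ (Fin n))) := by
    rw [← Submodule.map_comap_subtype]
    exact (Submodule.finrank_map_subtype_eq W _).symm
  omega

end Cells

/-! ### Dimension of sets of lines -/

open Filter Topology

section Lines

variable {n : ℕ}

theorem starProjection_line_apply (w x : EuclideanSpace ℝ (Fin n)) :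
    (Submodule.span ℝ {w}).starProjection x = ((‖w‖ ^ 2)⁻¹ * inner ℝ w x) • w := by
  rw [Submodule.starProjection_singleton]
  congr 1
  simp [div_eq_inv_mul]

/-- The projections to the lines spanned by the points of an affine space avoiding `0`. -/
theorem contDiff_starProjection_line {K : Submodule ℝ (EuclideanSpace ℝ (Fin n))}
    {w : EuclideanSpace ℝ (Fin n)} (hw : ∀ u : K, w + u ≠ 0) :
    ContDiff ℝ 1 fun u : K => (Submodule.span ℝ {w + (u : EuclideanSpace ℝ (Fin n))}).starProjection := by
  have he : (fun u : K => (Submodule.span ℝ {w + (u : EuclideanSpace ℝ (Fin n))}).starProjection) =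
      fun u : K => (‖w + (u : EuclideanSpace ℝ (Fin n))‖ ^ 2)⁻¹ •
        (innerSL ℝ (w + (u : EuclideanSpace ℝ (Fin n)))).smulRight
          (w + (u : EuclideanSpace ℝ (Fin n))) := by
    ext1 u
    ext1 x
    rw [starProjection_line_apply, mul_smul]
    rfl
  rw [he]
  have h1 : ContDiff ℝ 1 fun u : K => w + (u : EuclideanSpace ℝ (Fin n)) :=
    contDiff_const.add K.subtypeL.contDiff
  refine ContDiff.smul (ContDiff.inv (h1.norm_sq ℝ) fun u => ?_) ?_
  · exact pow_ne_zero _ (norm_ne_zero_iff.2 (hw u))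
  · exact ((innerSL ℝ).contDiff.comp h1).smulRight h1

/-- The dimension of a set of lines, in the affine chart in which the coordinate `j` is `1`. -/
theorem hasDimension_of_lines {B : Set (Submodule ℝ (EuclideanSpace ℝ (Fin n)))}
    (K : Submodule ℝ (EuclideanSpace ℝ (Fin n))) (w : EuclideanSpace ℝ (Fin n)) (j : Fin n)
    (hw : w j = 1) (hK : ∀ u ∈ K, u j = 0) (hB : ∀ X ∈ B, ∃ u : K, X = Submodule.span ℝ {w + ↑u})
    (u₀ : K) (hu₀ : ∀ᶠ u : K in 𝓝 u₀, Submodule.span ℝ {w + ↑u} ∈ B) :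
    HasDimension B (Module.finrank ℝ K) := by
  let E := EuclideanSpace ℝ (Fin n)
  let f : K → E →L[ℝ] E := fun u => (Submodule.span ℝ {w + (u : E)}).starProjection
  let ej : E := EuclideanSpace.single j 1
  -- The inverse of the chart: the projection onto a line sends `e_j` to a multiple of the spanning
  -- vector, which is then normalised to have coordinate `j` equal to `1`.
  let g : (E →L[ℝ] E) → E := fun P => (P ej j)⁻¹ • P ej
  let s : Set (E →L[ℝ] E) := {P | 0 < P ej j}
  have hcoord : ∀ u : K, (w + (u : E)) j = 1 := fun u => by simp [hw, hK u u.2]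
  have hne : ∀ u : K, w + (u : E) ≠ 0 := fun u h => by
    have := hcoord u
    rw [h] at this
    simp at this
  have hfe : ∀ u : K, f u ej = (‖w + (u : E)‖ ^ 2)⁻¹ • (w + (u : E)) := by
    intro u
    have h1 : inner ℝ (w + (u : E)) ej = 1 := by
      simp only [ej, EuclideanSpace.inner_single_right]
      simpa using hcoord u
    exact (starProjection_line_apply _ _).trans (by rw [h1, mul_one])
  have hfej : ∀ u : K, f u ej j = (‖w + (u : E)‖ ^ 2)⁻¹ := by
    intro u
    rw [hfe, PiLp.smul_apply, hcoord, smul_eq_mul, mul_one]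
  have hfs : ∀ u, f u ∈ s := by
    intro u
    change 0 < f u ej j
    rw [hfej]
    have := norm_pos_iff.2 (hne u)
    positivity
  have hgf : ∀ u, g (f u) = w + (u : E) := by
    intro u
    have := norm_ne_zero_iff.2 (hne u)
    simp only [g]
    rw [hfej, hfe, smul_smul, inv_mul_cancel₀ (by positivity), one_smul]
  have hf : ContDiff ℝ 1 f := contDiff_starProjection_line hne
  have hev : ContDiff ℝ 1 fun P : E →L[ℝ] E => P ej :=
    (ContinuousLinearMap.apply ℝ E ej).contDiff
  have hev' : ContDiff ℝ 1 fun P : E →L[ℝ] E => P ej j :=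
    (EuclideanSpace.proj j : E →L[ℝ] ℝ).contDiff.comp hev
  have hg : ContDiffOn ℝ 1 g s :=
    (hev'.contDiffOn.inv fun P hP => ne_of_gt hP).smul hev.contDiffOn
  -- A `C¹` map on a convex set does not raise Hausdorff dimension; this is applied to `g` on `s`.
  have hs : Convex ℝ s := by
    intro P hP Q hQ a b ha hb hab
    change 0 < (a • P + b • Q) ej j
    have h1 : (a • P + b • Q) ej j = a * P ej j + b * Q ej j := rfl
    have hP' : 0 < P ej j := hP
    have hQ' : 0 < Q ej j := hQ
    rw [h1]
    rcases ha.eq_or_lt with rfl | ha'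
    · rw [zero_add] at hab
      simp [hab, hQ']
    · exact add_pos_of_pos_of_nonneg (mul_pos ha' hP') (mul_nonneg hb hQ'.le)
  have hiso : Isometry fun u : K => w + (u : E) :=
    (IsometryEquiv.addLeft w).isometry.comp K.subtypeₗᵢ.isometry
  have hemb : IsEmbedding f := by
    have h1 : IsEmbedding (fun u : K => (⟨f u, hfs u⟩ : s)) := by
      refine IsEmbedding.of_comp (g := fun P : s => g P) (hf.continuous.subtype_mk _)
        (continuousOn_iff_continuous_domRestrict.1 hg.continuousOn) ?_
      have : (fun P : s => g P) ∘ (fun u : K => (⟨f u, hfs u⟩ : s)) = fun u : K => w + (u : E) :=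
        funext hgf
      rw [this]
      exact hiso.isEmbedding
    exact IsEmbedding.subtypeVal.comp h1
  obtain ⟨ε, hε, hball⟩ := Metric.eventually_nhds_iff_ball.1 hu₀
  have hsub : f '' Metric.ball u₀ ε ⊆ projections B := by
    rintro _ ⟨u, hu, rfl⟩
    exact ⟨_, hball u hu, rfl⟩
  refine ⟨?_, le_antisymm ?_ ?_⟩
  -- A ball of `K` is homeomorphic to `K`, hence to a Euclidean space.
  · let φ : EuclideanSpace ℝ (Fin (Module.finrank ℝ K)) ≃L[ℝ] K :=
      ContinuousLinearEquiv.ofFinrankEq (by simp)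
    let ψ := OpenPartialHomeomorph.univBall u₀ ε
    have hψ : IsOpenEmbedding ψ := ψ.isOpenEmbedding (OpenPartialHomeomorph.univBall_source _ _)
    refine ⟨f ∘ ψ ∘ φ, hemb.comp (hψ.isEmbedding.comp φ.toHomeomorph.isEmbedding), ?_⟩
    rintro _ ⟨x, rfl⟩
    refine hsub ⟨ψ (φ x), ?_, rfl⟩
    rw [← OpenPartialHomeomorph.univBall_target u₀ hε]
    exact ψ.map_source (by simp [ψ])
  · refine (dimH_mono ?_).trans hf.dimH_range_le
    rintro _ ⟨X, hX, rfl⟩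
    obtain ⟨u, rfl⟩ := hB X hX
    exact ⟨u, rfl⟩
  -- The isometric copy `w + ball` is recovered from the projections by `g`, which gives the lower
  -- bound.
  · have h1 : dimH (Metric.ball u₀ ε) = Module.finrank ℝ K :=
      Real.dimH_of_nonempty_interior ⟨u₀, by
        rw [Metric.isOpen_ball.interior_eq]; exact Metric.mem_ball_self hε⟩
    have h2 : g '' (f '' Metric.ball u₀ ε) = (fun u : K => w + (u : E)) '' Metric.ball u₀ ε := by
      rw [Set.image_image]
      exact Set.image_congr fun u _ => hgf u
    rw [← h1, ← hiso.dimH_image, ← h2]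
    refine (hg.dimH_image_le hs ?_).trans (dimH_mono hsub)
    rintro _ ⟨u, -, rfl⟩
    exact hfs u

end Lines

/-! ### The dimension of the image of the cell -/

/-- The labels of the rows without `+`. -/
def LeDiagram.emptyRowLabels {k n : ℕ} (D : LeDiagram k n) : Finset (Fin n) :=
  (Finset.univ \ D.plus.image Prod.fst).image D.rowLabel

theorem LeDiagram.card_emptyRowLabels {k n : ℕ} (D : LeDiagram k n) :
    D.emptyRowLabels.card + D.numPlusRows = k := by
  rw [emptyRowLabels, Finset.card_image_of_injective _ D.rowLabel_strictMono.injective, numPlusRows,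
    Finset.card_sdiff_add_card_eq_card (Finset.subset_univ _), Finset.card_univ, Fintype.card_fin]

theorem LeDiagram.mem_of_mem_emptyRowLabels {k n : ℕ} (D : LeDiagram k n) {i : Fin n}
    (hi : i ∈ D.emptyRowLabels) {I : Finset (Fin n)} (hI : I ∈ D.positroid) : i ∈ I := by
  simp only [emptyRowLabels, Finset.mem_image, Finset.mem_sdiff, Finset.mem_univ, true_and] at hi
  obtain ⟨r, hr, rfl⟩ := hi
  exact D.rowLabel_mem_of_mem_positroid (fun c hc => hr ⟨_, hc, rfl⟩) hI

theorem LeDiagram.exists_notMem_of_notMem_emptyRowLabels {k n : ℕ} (D : LeDiagram k n) {i : Fin n}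
    (hi : i ∉ D.emptyRowLabels) :
    ∃ I : {I : Finset (Fin n) // I.card = k}, I.1 ∈ D.positroid ∧ i ∉ I.1 := by
  have : ∃ I ∈ D.positroid, i ∉ I := by
    rcases D.exists_label i with ⟨r, rfl⟩ | ⟨c, rfl⟩
    · have h : ∃ c, (r, c) ∈ D.plus := by
        by_contra hcon
        push Not at hcon
        refine hi (Finset.mem_image.2 ⟨r, ?_, rfl⟩)
        simp [hcon]
      obtain ⟨c, hc⟩ := h
      exact D.exists_mem_positroid_rowLabel_notMem hc
    · exact D.exists_mem_positroid_colLabel_notMem c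
  obtain ⟨I, hI, hiI⟩ := this
  exact ⟨⟨I, D.exists_hasCell.2 I hI⟩, hI, hiI⟩

theorem mainTheorem7 (k n : ℕ) (W : Submodule ℝ (EuclideanSpace ℝ (Fin n)))
    (hW : W ∈ totallyPositiveGrassmannian (k + 1) n) (D : LeDiagram k n) :
    HasDimension (D.image W) D.numPlusRows := by
  obtain ⟨C, hCW, hC⟩ := hW
  have hcard := D.card_emptyRowLabels
  have hkn : k + 1 ≤ n := by
    have := Submodule.finrank_le W
    rw [hCW.1] at this
    simpa using this
  have hZ : (Finset.univ \ D.emptyRowLabels).Nonempty := by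
    rw [← Finset.card_pos, Finset.card_sdiff_of_subset (Finset.subset_univ _), Finset.card_univ,
      Fintype.card_fin]
    omega
  -- The smallest label that is not in every basis; it exists because at most `k < n` labels belong
  -- to empty rows.
  set j := (Finset.univ \ D.emptyRowLabels).min' hZ with hj
  have hjZ : j ∉ D.emptyRowLabels := by
    have := Finset.min'_mem _ hZ
    rw [← hj] at this
    simpa using this
  have hlt : ∀ i < j, i ∈ D.emptyRowLabels := by
    intro i hi
    by_contra hcon
    exact absurd (Finset.min'_le (Finset.univ \ D.emptyRowLabels) i (by simp [hcon])) (not_le.2 hi)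
  obtain ⟨I₀, hI₀, hjI₀⟩ := D.exists_notMem_of_notMem_emptyRowLabels hjZ
  have hzero : ∀ A : Matrix (Fin k) (Fin n) ℝ, HasCell A D.positroid → ∀ w ∈ W,
      A *ᵥ w.ofLp = 0 → w j = 0 → w = 0 := by
    intro A hA w hw hAw hwj
    exact eq_zero_of_det_ne_zero hCW (hA.det_consUnitRow_ne_zero hC
      (fun I hI i hi => D.mem_of_mem_emptyRowLabels (hlt i hi) hI) hI₀ hjI₀) hw
      (consUnitRow_mulVec_eq_zero hwj hAw)
  have hspan : ∀ (A : Matrix (Fin k) (Fin n) ℝ) (V : Submodule ℝ (EuclideanSpace ℝ (Fin n))),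
      Represents A V → HasCell A D.positroid → ∀ w ∈ W, A *ᵥ w.ofLp = 0 → w j = 1 →
      Vᗮ ⊓ W = Submodule.span ℝ {w} := by
    intro A V hV hA w hw hAw hwj
    refine le_antisymm (fun x hx => ?_) ?_
    · obtain ⟨hx1, hx2⟩ := hx
      have hAx := (hV.mem_orthogonal_iff x).1 hx1
      -- The difference lies in the same intersection and has coordinate `j` equal to zero.
      have h0 : x - x j • w = 0 := by
        refine hzero A hA _ (W.sub_mem hx2 (W.smul_mem _ hw)) ?_ (by simp [hwj])
        rw [WithLp.ofLp_sub, WithLp.ofLp_smul, mulVec_sub, mulVec_smul, hAx, hAw, smul_zero, sub_zero]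
      rw [sub_eq_zero.1 h0]
      exact Submodule.smul_mem _ _ (Submodule.mem_span_singleton_self w)
    · rw [Submodule.span_singleton_le_iff_mem]
      exact ⟨(hV.mem_orthogonal_iff w).2 hAw, hw⟩
  obtain ⟨⟨A₀, hA₀⟩, -⟩ := D.exists_hasCell
  obtain ⟨A, hA, w, hwW, hAw, hwne⟩ := hA₀.exists_generic hC hCW (Finset.univ \ D.emptyRowLabels)
    fun i hi => D.exists_notMem_of_notMem_emptyRowLabels (by simpa using hi)
  have hwj0 : w j ≠ 0 := hwne j (by simp [hjZ])
  set w₀ := (w j)⁻¹ • w with hw₀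
  have hw₀W : w₀ ∈ W := W.smul_mem _ hwW
  have hAw₀ : A *ᵥ w₀.ofLp = 0 := by rw [hw₀, WithLp.ofLp_smul, mulVec_smul, hAw, smul_zero]
  have hw₀j : w₀ j = 1 := by simp [hw₀, hwj0]
  have hw₀ne : ∀ i ∉ D.emptyRowLabels, w₀ i ≠ 0 := by
    intro i hi
    simp [hw₀, hwj0, hwne i (by simp [hi])]
  have hvanish : ∀ B : Matrix (Fin k) (Fin n) ℝ, HasCell B D.positroid →
      ∀ v : Fin n → ℝ, B *ᵥ v = 0 → ∀ i ∈ D.emptyRowLabels, v i = 0 := by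
    intro B hB v hv i hi
    exact hB.coord_eq_zero hI₀ (fun I hI => D.mem_of_mem_emptyRowLabels hi hI) hv
  -- The directions of the affine chart: coordinate `j` is fixed at `1`, and the coordinates of
  -- empty rows stay zero.
  set K : Submodule ℝ (EuclideanSpace ℝ (Fin n)) := W ⊓ coordKer (insert j D.emptyRowLabels) with hKdef
  have hKrank : Module.finrank ℝ K = D.numPlusRows := by
    have h1 := Finset.card_insert_of_notMem hjZ
    have h2 := finrank_inf_coordKer hC hCW (S := insert j D.emptyRowLabels) (by omega)
    rw [← hKdef] at h2
    omega
  rw [← hKrank]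
  refine hasDimension_of_lines K w₀ j hw₀j (fun u hu => hu.2 j (Finset.mem_insert_self _ _)) ?_ 0 ?_
  · rintro X ⟨V, ⟨B, hBV, hB⟩, rfl⟩
    obtain ⟨x, hxW, hx0, hBx⟩ := exists_mem_mulVec_eq_zero hCW.1 B
    have hxj : x j ≠ 0 := fun h => hx0 (hzero B hB x hxW hBx h)
    have hBx' : B *ᵥ ((x j)⁻¹ • x).ofLp = 0 := by rw [WithLp.ofLp_smul, mulVec_smul, hBx, smul_zero]
    refine ⟨⟨(x j)⁻¹ • x - w₀, W.sub_mem (W.smul_mem _ hxW) hw₀W, fun i hi => ?_⟩, ?_⟩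
    · rcases Finset.mem_insert.1 hi with rfl | hi
      · simp [hw₀j, hxj]
      · have h1 := hvanish B hB _ hBx' i hi
        have h2 := hvanish A hA _ hAw₀ i hi
        rw [PiLp.sub_apply, h1, h2, sub_zero]
    · rw [add_sub_cancel]
      exact hspan B V hBV hB _ (W.smul_mem _ hxW) hBx' (by simp [hxj])
  -- Near `w₀` the nonzero coordinates keep their signs, so rescaling the columns of `A` produces a
  -- point of the cell orthogonal to the perturbed vector.
  · have hsign : ∀ᶠ u : K in 𝓝 0, ∀ i, i ∉ D.emptyRowLabels →
        0 < w₀ i * (w₀ + (u : EuclideanSpace ℝ (Fin n))) i := by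
      rw [eventually_all]
      intro i
      by_cases hi : i ∈ D.emptyRowLabels
      · exact Eventually.of_forall fun u h => absurd hi h
      · have hcont : Continuous fun u : K => w₀ i * (w₀ + (u : EuclideanSpace ℝ (Fin n))) i := by
          fun_prop
        have h0 : 0 < w₀ i * (w₀ + ((0 : K) : EuclideanSpace ℝ (Fin n))) i := by
          simpa using mul_self_pos.2 (hw₀ne i hi)
        exact (hcont.continuousAt.eventually (lt_mem_nhds h0)).mono fun u hu _ => hu
    filter_upwards [hsign] with u hu
    obtain ⟨huW, huZ⟩ := u.2
    obtain ⟨A', hA', hA'w⟩ := hA.exists_of_sign hAw₀ (v' := (w₀ + (u : EuclideanSpace ℝ (Fin n))).ofLp)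
      (by
        intro i
        by_cases hi : i ∈ D.emptyRowLabels
        · right
          have h2 := hvanish A hA _ hAw₀ i hi
          refine ⟨h2, ?_⟩
          rw [PiLp.add_apply, h2, huZ i (Finset.mem_insert_of_mem hi), add_zero]
        · exact Or.inl (hu i hi))
    have hrep := represents_span (A := A') ((hA' I₀).1 hI₀).ne'
    refine ⟨_, ⟨A', hrep, hA'⟩, (hspan A' _ hrep hA' _ (W.add_mem hw₀W huW) hA'w ?_).symm⟩
    rw [PiLp.add_apply, hw₀j, huZ j (Finset.mem_insert_self _ _), add_zero]
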